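/- Let $d\ge 2$ and let $V:[0,\infty)\to\mathbb{C}$ be differentiable with $|V(r)|\le K\langle r\rangle^{-2}$ and $|V'(r)|\le K\langle r\rangle^{-3}$ for all $r\ge 0$ and some constant $K$, where $\langle r\rangle=\sqrt{1+r^2}$. Put $\mathcal L_V u(x)=\Delta u(x)-2x\cdot\nabla u(x)+V(|x|)u(x)$ and let $L$ be the closure in $L^2(\mathbb{R}^d)$ of the operator $u\mapsto \mathcal L_V u$ with domain $\{u\in H^2(\mathbb{R}^d)\cap C^\infty(\mathbb{R}^d):\mathcal L_V u\in L^2(\mathbb{R}^d)\}$. Write $\rho(L)$ for the resolvent set of $L$ and $R(\lambda)=(\lambda-L)^{-1}$ for $\lambda\in\rho(L)$. Let $L^2_{\mathrm{rad}}(\mathbb{R}^d)=L^2((0,\infty),r^{d-1}dr)$, and let $\sigma$ be the surface measure on $S^{d-1}$. Let $Y_{\ell,m}$ be spherical harmonics, i.e. $L^2(S^{d-1})$-normalized smooth eigenfunctions of the (positive) Laplace–Beltrami operator on $S^{d-1}$ with eigenvalue $\ell(\ell+d-2)$, $\ell\in\mathbb{N}_0$. Define the bounded operators $$P_{\ell,m}:L^2(\mathbb{R}^d)\to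 L^2_{\mathrm{rad}}(\mathbb{R}^d),\quad [P_{\ell,m}f](r)=\int_{S^{d-1}}f(r\theta)\overline{Y_{\ell,m}(\theta)}\,d\sigma(\theta),$$ $$Q_{\ell,m}:L^2_{\mathrm{rad}}(\mathbb{R}^d)\to L^2(\mathbb{R}^d),\quad [Q_{\ell,m}g](x)=g(|x|)\,Y_{\ell,m}(x/|x|),$$ and, for $\lambda\in\rho(L)$, the reduced resolvent $R_{\ell,m}(\lambda)=P_{\ell,m}R(\lambda)Q_{\ell,m}$ on $L^2_{\mathrm{rad}}(\mathbb{R}^d)$. Then for every $b>0$ there are constants $C$ and $\omega_0$ such that for all $\omega\ge\omega_0$ one has $d+b+i\omega\in\rho(L)$ and $$\|R_{\ell,m}(d+b+i\omega)\|_{L^2_{\mathrm{rad}}(\mathbb{R}^d)\to L^2_{\mathrm{rad}}(\mathbb{R}^d)}\le C$$ for every $\ell\in\mathbb{N}_0$ and every such normalized spherical harmonic $Y_{\ell,m}$ of degree $\ell$. The constants $C$ and $\omega_0$ do not depend on $\omega$, $\ell$ or $m$. -/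

import Mathlib

noncomputable section

namespace OrnsteinUhlenbeck

open MeasureTheory Set Metric Filter
open scoped ENNReal ComplexConjugate

/-- The space `ℝ^d` with its Euclidean norm. -/
abbrev E (d : ℕ) : Type := EuclideanSpace ℝ (Fin d)

/-- The unit sphere `S^{d-1}` of `ℝ^d`. -/
abbrev Sph (d : ℕ) : Type := sphere (0 : E d) 1

/-- The surface measure on `S^{d-1}`. -/
abbrev surf (d : ℕ) : Measure (Sph d) := (volume : Measure (E d)).toSphere

/-- The measure `r^{d-1} dr` on `(0, ∞)`. -/
abbrev radMeasure (d : ℕ) : Measure (Ioi (0 : ℝ)) := Measure.volumeIoiPow (d - 1)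

/-- The complex Hilbert space `L²(ℝ^d)`. -/
abbrev L2 (d : ℕ) : Type := Lp ℂ 2 (volume : Measure (E d))

/-- The space `L²_rad(ℝ^d)`, with norm `‖g‖² = ∫_0^∞ |g(r)|² r^{d-1} dr`. -/
abbrev L2rad (d : ℕ) : Type := Lp ℂ 2 (radMeasure d)

/-! ### The operator -/

theorem natCast_le_infty (n : ℕ) : (n : WithTop ℕ∞) ≤ ((⊤ : ℕ∞) : WithTop ℕ∞) :=
  by exact_mod_cast (le_top : (n : ℕ∞) ≤ ⊤)

/-- The formal differential expression `Δ u(x) - 2 x · ∇u(x) + V(|x|) u(x)`. -/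
def formalOp {d : ℕ} (V : ℝ → ℂ) (u : E d → ℂ) (x : E d) : ℂ :=
  Laplacian.laplacian u x - 2 * fderiv ℝ u x x + V ‖x‖ * u x

/-- `u ∈ H²(ℝ^d) ∩ C^∞(ℝ^d)` and `𝓛_V u ∈ L²(ℝ^d)`. As `u` is smooth, its weak derivatives are the
classical ones, so that `u ∈ H²` says that the derivatives of order at most two are in `L²`. -/
structure IsAdmissible {d : ℕ} (V : ℝ → ℂ) (u : E d → ℂ) : Prop where
  smooth : ContDiff ℝ ((⊤ : ℕ∞) : WithTop ℕ∞) u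
  sobolev : ∀ k : ℕ, k ≤ 2 → MemLp (iteratedFDeriv ℝ k u) 2 volume
  memLp_op : MemLp (formalOp V u) 2 volume

theorem formalOp_add {d : ℕ} (V : ℝ → ℂ) {u v : E d → ℂ} (hu : ContDiff ℝ ((⊤ : ℕ∞) : WithTop ℕ∞) u)
    (hv : ContDiff ℝ ((⊤ : ℕ∞) : WithTop ℕ∞) v) : formalOp V (u + v) = formalOp V u + formalOp V v := by
  funext x
  have hu2 : ContDiffAt ℝ 2 u x := (hu.of_le (natCast_le_infty _)).contDiffAt
  have hv2 : ContDiffAt ℝ 2 v x := (hv.of_le (natCast_le_infty _)).contDiffAt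
  have hu1 : DifferentiableAt ℝ u x := hu2.differentiableAt (by norm_num)
  have hv1 : DifferentiableAt ℝ v x := hv2.differentiableAt (by norm_num)
  simp only [formalOp, Pi.add_apply, hu2.laplacian_add hv2, fderiv_add hu1 hv1,
    add_apply]
  ring

theorem formalOp_smul {d : ℕ} (V : ℝ → ℂ) (c : ℂ) {u : E d → ℂ} (hu : ContDiff ℝ ((⊤ : ℕ∞) : WithTop ℕ∞) u) :
    formalOp V (c • u) = c • formalOp V u := by
  funext x
  have hu2 : ContDiffAt ℝ 2 u x := (hu.of_le (natCast_le_infty _)).contDiffAt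
  have hu1 : DifferentiableAt ℝ u x := hu2.differentiableAt (by norm_num)
  have h1 : Laplacian.laplacian (c • u) x = c • Laplacian.laplacian u x := by
    have := hu2.laplacian_CLM_comp_left (l := (c • ContinuousLinearMap.id ℝ ℂ))
    simpa [Function.comp_def, Pi.smul_def] using this
  simp only [formalOp, Pi.smul_apply, h1, fderiv_const_smul hu1, smul_apply,
    smul_eq_mul]
  ring

theorem IsAdmissible.zero {d : ℕ} (V : ℝ → ℂ) : IsAdmissible V (0 : E d → ℂ) := by
  have h0 : formalOp V (0 : E d → ℂ) = 0 := by
    have := formalOp_smul V 0 (u := (0 : E d → ℂ)) contDiff_const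
    simpa using this
  refine ⟨contDiff_const, fun k _ => ?_, ?_⟩
  · have : iteratedFDeriv ℝ k (0 : E d → ℂ) = 0 := iteratedFDeriv_fun_zero
    rw [this]
    exact MemLp.zero
  · rw [h0]
    exact MemLp.zero

theorem IsAdmissible.add {d : ℕ} {V : ℝ → ℂ} {u v : E d → ℂ} (hu : IsAdmissible V u)
    (hv : IsAdmissible V v) : IsAdmissible V (u + v) := by
  refine ⟨hu.smooth.add hv.smooth, fun k hk => ?_, ?_⟩
  · rw [iteratedFDeriv_add (hu.smooth.of_le (natCast_le_infty _))
      (hv.smooth.of_le (natCast_le_infty _))]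
    exact (hu.sobolev k hk).add (hv.sobolev k hk)
  · rw [formalOp_add V hu.smooth hv.smooth]
    exact hu.memLp_op.add hv.memLp_op

theorem IsAdmissible.smul {d : ℕ} {V : ℝ → ℂ} {u : E d → ℂ} (c : ℂ) (hu : IsAdmissible V u) :
    IsAdmissible V (c • u) := by
  refine ⟨hu.smooth.const_smul c, fun k hk => ?_, ?_⟩
  · have : iteratedFDeriv ℝ k (c • u) = c • iteratedFDeriv ℝ k u := by
      funext x
      exact iteratedFDeriv_const_smul_apply
        (hu.smooth.of_le (natCast_le_infty _)).contDiffAt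
    rw [this]
    exact (hu.sobolev k hk).const_smul c
  · rw [formalOp_smul V c hu.smooth]
    exact hu.memLp_op.const_smul c

/-- The domain of the preclosed operator, as a subspace of `L²(ℝ^d)`: the classes of the admissible
functions. -/
def preDomain (d : ℕ) (V : ℝ → ℂ) : Submodule ℂ (L2 d) where
  carrier := {f | ∃ u : E d → ℂ, IsAdmissible V u ∧ f =ᵐ[volume] u}
  zero_mem' := ⟨0, IsAdmissible.zero V, Lp.coeFn_zero _ _ _⟩
  add_mem' := by
    rintro f g ⟨u, hu, hfu⟩ ⟨v, hv, hgv⟩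
    exact ⟨u + v, hu.add hv, (Lp.coeFn_add f g).trans (hfu.add hgv)⟩
  smul_mem' := by
    rintro c f ⟨u, hu, hfu⟩
    exact ⟨c • u, hu.smul c, (Lp.coeFn_smul c f).trans (hfu.const_smul c)⟩

/-- The smooth representative of an element of the domain. -/
def rep {d : ℕ} {V : ℝ → ℂ} (f : preDomain d V) : E d → ℂ := f.2.choose

theorem rep_admissible {d : ℕ} {V : ℝ → ℂ} (f : preDomain d V) : IsAdmissible V (rep f) :=
  f.2.choose_spec.1

theorem rep_ae_eq {d : ℕ} {V : ℝ → ℂ} (f : preDomain d V) : (f : L2 d) =ᵐ[volume] rep f :=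
  f.2.choose_spec.2

theorem rep_unique {d : ℕ} {V : ℝ → ℂ} (f : preDomain d V) {u : E d → ℂ}
    (hu : IsAdmissible V u) (h : (f : L2 d) =ᵐ[volume] u) : rep f = u :=
  ((rep_admissible f).smooth.continuous.ae_eq_iff_eq volume hu.smooth.continuous).1
    ((rep_ae_eq f).symm.trans h)

/-- The operator `u ↦ 𝓛_V u` on its domain `{u ∈ H² ∩ C^∞ : 𝓛_V u ∈ L²}`. -/
def preOp (d : ℕ) (V : ℝ → ℂ) : L2 d →ₗ.[ℂ] L2 d where
  domain := preDomain d V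
  toFun :=
    { toFun := fun f => (rep_admissible f).memLp_op.toLp (formalOp V (rep f))
      map_add' := fun f g => by
        have h : rep (f + g) = rep f + rep g :=
          rep_unique _ ((rep_admissible f).add (rep_admissible g))
            ((Lp.coeFn_add _ _).trans ((rep_ae_eq f).add (rep_ae_eq g)))
        rw [← MemLp.toLp_add]
        congr 1
        rw [h, formalOp_add V (rep_admissible f).smooth (rep_admissible g).smooth]
      map_smul' := fun c f => by
        have h : rep (c • f) = c • rep f :=
          rep_unique _ ((rep_admissible f).smul c)
            ((Lp.coeFn_smul _ _).trans ((rep_ae_eq f).const_smul c))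
        rw [RingHom.id_apply, ← MemLp.toLp_const_smul]
        congr 1
        rw [h, formalOp_smul V c (rep_admissible f).smooth] }

/-- The operator `L`, the closure of `u ↦ 𝓛_V u`. -/
def op (d : ℕ) (V : ℝ → ℂ) : L2 d →ₗ.[ℂ] L2 d := (preOp d V).closure

/-! ### Resolvents of unbounded operators -/

/-- `R` is a bounded everywhere defined two-sided inverse of `z - A : 𝓓(A) → X`. -/
def IsResolventAt {X : Type*} [NormedAddCommGroup X] [NormedSpace ℂ X] (A : X →ₗ.[ℂ] X) (z : ℂ)
    (R : X →L[ℂ] X) : Prop :=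
  (∀ f : X, ∃ h : R f ∈ A.domain, z • R f - A ⟨R f, h⟩ = f) ∧
    ∀ u : A.domain, R (z • (u : X) - A u) = u

/-- The resolvent set `ρ(A)`. -/
def resolventSet {X : Type*} [NormedAddCommGroup X] [NormedSpace ℂ X] (A : X →ₗ.[ℂ] X) : Set ℂ :=
  {z | ∃ R : X →L[ℂ] X, IsResolventAt A z R}

open Classical in
/-- The resolvent `(z - A)⁻¹` for `z ∈ ρ(A)` (and `0` for other `z`). -/
def resolvent {X : Type*} [NormedAddCommGroup X] [NormedSpace ℂ X] (A : X →ₗ.[ℂ] X) (z : ℂ) :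
    X →L[ℂ] X :=
  if h : z ∈ resolventSet A then h.choose else 0

theorem IsResolventAt.resolvent_eq {X : Type*} [NormedAddCommGroup X] [NormedSpace ℂ X]
    {A : X →ₗ.[ℂ] X} {z : ℂ} {R : X →L[ℂ] X} (hR : IsResolventAt A z R) : resolvent A z = R := by
  have h : z ∈ resolventSet A := ⟨R, hR⟩
  have h' : IsResolventAt A z (resolvent A z) := by
    rw [resolvent, dif_pos h]
    exact h.choose_spec
  ext f
  obtain ⟨hf, e⟩ := hR.1 f
  have := h'.2 ⟨R f, hf⟩
  rwa [e] at this

/-! ### Spherical harmonics -/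

/-- The extension of a function on the sphere to a function on `ℝ^d \ {0}` which is homogeneous of
degree zero, `x ↦ Y(x / |x|)` (with value `0` at the origin). -/
def homExt {d : ℕ} (Y : Sph d → ℂ) (x : E d) : ℂ :=
  if h : x ≠ 0 then Y ⟨‖x‖⁻¹ • x, by simp [norm_smul, h]⟩ else 0

/-- An `L²(S^{d-1})`-normalized spherical harmonic of degree `ℓ`: a smooth eigenfunction of the
(positive) Laplace-Beltrami operator on the sphere with eigenvalue `ℓ(ℓ+d-2)`. The Laplace-Beltrami
operator on the sphere is the Laplacian of the extension that is homogeneous of degree zero,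
restricted to the sphere. -/
structure SphericalHarmonic (d ℓ : ℕ) where
  /-- the underlying function on the sphere -/
  toFun : Sph d → ℂ
  smooth : ContDiffOn ℝ ((⊤ : ℕ∞) : WithTop ℕ∞) (homExt toFun) {0}ᶜ
  eigen : ∀ ω : Sph d, -Laplacian.laplacian (homExt toFun) (ω : E d)
    = ((ℓ : ℂ) * ((ℓ : ℂ) + (d : ℂ) - 2)) * toFun ω
  normalized : ∫ ω, ‖toFun ω‖ ^ 2 ∂(surf d) = 1

instance {d ℓ : ℕ} : CoeFun (SphericalHarmonic d ℓ) (fun _ => Sph d → ℂ) := ⟨fun Y => Y.toFun⟩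

theorem homExt_coe {d : ℕ} (Y : Sph d → ℂ) (ω : Sph d) : homExt Y (ω : E d) = Y ω := by
  have h1 : ‖(ω : E d)‖ = 1 := by simp
  have h : (ω : E d) ≠ 0 := by
    intro h0
    rw [h0, norm_zero] at h1
    exact zero_ne_one h1
  rw [homExt, dif_pos h]
  congr 1
  ext1
  simp

theorem SphericalHarmonic.continuous {d ℓ : ℕ} (Y : SphericalHarmonic d ℓ) :
    Continuous (Y : Sph d → ℂ) := by
  have h : (Y : Sph d → ℂ) = fun ω : Sph d => homExt Y.toFun (ω : E d) :=
    funext fun ω => (homExt_coe Y.toFun ω).symm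
  rw [h]
  refine Y.smooth.continuousOn.comp_continuous continuous_subtype_val fun ω h0 => ?_
  have h1 : ‖(ω : E d)‖ = 1 := by simp
  rw [mem_singleton_iff] at h0
  rw [h0, norm_zero] at h1
  exact zero_ne_one h1

theorem SphericalHarmonic.lintegral_sq {d ℓ : ℕ} (Y : SphericalHarmonic d ℓ) :
    ∫⁻ ω, ‖Y ω‖ₑ ^ 2 ∂(surf d) = 1 := by
  have hi : Integrable (fun ω => ‖Y ω‖ ^ 2) (surf d) :=
    (Y.continuous.norm.pow 2).integrable_of_hasCompactSupport (HasCompactSupport.of_compactSpace _)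
  have := ofReal_integral_eq_lintegral_ofReal hi (ae_of_all _ fun ω => by positivity)
  rw [Y.normalized, ENNReal.ofReal_one] at this
  rw [this]
  refine lintegral_congr fun ω => ?_
  rw [← ofReal_norm, ENNReal.ofReal_pow (norm_nonneg _)]

/-! ### Polar coordinates and the angular decomposition -/

/-- Polar coordinates `(ω, r) ↦ r ω`. -/
def polar {d : ℕ} (p : Sph d × Ioi (0 : ℝ)) : E d := (p.2 : ℝ) • (p.1 : E d)

theorem polar_ne_zero {d : ℕ} (p : Sph d × Ioi (0 : ℝ)) : polar p ≠ 0 := by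
  have h1 : ‖(p.1 : E d)‖ = 1 := by simp
  have h2 : (p.2 : ℝ) ≠ 0 := ne_of_gt p.2.2
  intro h
  rcases smul_eq_zero.1 h with h | h
  · exact h2 h
  · rw [h, norm_zero] at h1
    exact zero_ne_one h1

theorem polar_eq {d : ℕ} :
    (polar : Sph d × Ioi (0 : ℝ) → E d) = Subtype.val ∘ (homeomorphUnitSphereProd (E d)).symm := by
  funext p
  simp [polar]

theorem measurableEmbedding_polar {d : ℕ} :
    MeasurableEmbedding (polar : Sph d × Ioi (0 : ℝ) → E d) := by
  rw [polar_eq]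
  exact (MeasurableEmbedding.subtype_coe (measurableSet_singleton _).compl).comp
    (Homeomorph.measurableEmbedding _)

theorem measurePreserving_polar (d : ℕ) :
    MeasurePreserving (polar : Sph d × Ioi (0 : ℝ) → E d) ((surf d).prod (radMeasure d))
      (volume.restrict {0}ᶜ) := by
  rw [polar_eq]
  have h := (volume : Measure (E d)).measurePreserving_homeomorphUnitSphereProd
  rw [finrank_euclideanSpace_fin] at h
  have h' := MeasurePreserving.symm (homeomorphUnitSphereProd (E d)).toMeasurableEquiv h
  exact (measurePreserving_subtype_coe (measurableSet_singleton _).compl).comp h'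

/-- The function `x ↦ g(|x|) Y(x/|x|)` (with value `0` at the origin). -/
def qFun {d : ℕ} (Y : Sph d → ℂ) (g : Ioi (0 : ℝ) → ℂ) (x : E d) : ℂ :=
  if h : x ≠ 0 then g ⟨‖x‖, norm_pos_iff.2 h⟩ * Y ⟨‖x‖⁻¹ • x, by simp [norm_smul, h]⟩ else 0

/-- The function `r ↦ ∫ f(rω) conj(Y(ω)) dσ(ω)`. -/
def pFun {d : ℕ} (Y : Sph d → ℂ) (f : E d → ℂ) (r : Ioi (0 : ℝ)) : ℂ :=
  ∫ ω : Sph d, f ((r : ℝ) • (ω : E d)) * conj (Y ω) ∂(surf d)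

theorem qFun_polar {d : ℕ} (Y : Sph d → ℂ) (g : Ioi (0 : ℝ) → ℂ) (p : Sph d × Ioi (0 : ℝ)) :
    qFun Y g (polar p) = g p.2 * Y p.1 := by
  have h1 : ‖(p.1 : E d)‖ = 1 := by simp
  have h2 : (0 : ℝ) < p.2 := p.2.2
  have h3 : ‖polar p‖ = (p.2 : ℝ) := by
    rw [polar, norm_smul, h1, mul_one, Real.norm_of_nonneg h2.le]
  rw [qFun, dif_pos (polar_ne_zero p)]
  congr 2
  · ext1
    exact h3
  · ext1
    simp only [h3]
    rw [polar, smul_smul, inv_mul_cancel₀ h2.ne', one_smul]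

theorem qFun_zero_apply {d : ℕ} (Y : Sph d → ℂ) (g : Ioi (0 : ℝ) → ℂ) : qFun Y g 0 = 0 := by
  simp [qFun]

theorem ae_eq_of_polar {d : ℕ} {F G : E d → ℂ} (h0 : F 0 = G 0)
    (h : F ∘ polar =ᵐ[(surf d).prod (radMeasure d)] G ∘ polar) : F =ᵐ[volume] G := by
  have h1 : F =ᵐ[volume.restrict {0}ᶜ] G := by
    have := (measurePreserving_polar d).map_eq
    rw [Filter.EventuallyEq, ← this, measurableEmbedding_polar.ae_map_iff]
    exact h
  have h2 := (ae_restrict_iff' (measurableSet_singleton (0 : E d)).compl).1 h1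
  filter_upwards [h2] with x hx
  by_cases hx0 : x = 0
  · rw [hx0, h0]
  · exact hx hx0

theorem ae_polar_of_ae_eq {d : ℕ} {F G : E d → ℂ} (h : F =ᵐ[volume] G) :
    F ∘ polar =ᵐ[(surf d).prod (radMeasure d)] G ∘ polar :=
  (measurePreserving_polar d).quasiMeasurePreserving.ae_eq_comp (ae_restrict_of_ae h)

theorem eLpNorm_two_sq {α : Type*} [MeasurableSpace α] (μ : Measure α) (F : α → ℂ) :
    eLpNorm F 2 μ ^ 2 = ∫⁻ a, ‖F a‖ₑ ^ 2 ∂μ := by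
  have h := eLpNorm_nnreal_pow_eq_lintegral (f := F) (μ := μ) (p := 2) (by norm_num)
  simpa using h

theorem eLpNorm_qFun {d ℓ : ℕ} (Y : SphericalHarmonic d ℓ) {g : Ioi (0 : ℝ) → ℂ}
    (hg : AEStronglyMeasurable g (radMeasure d)) :
    AEStronglyMeasurable (qFun Y g) (volume : Measure (E d)) ∧
      eLpNorm (qFun Y g) 2 (volume : Measure (E d)) = eLpNorm g 2 (radMeasure d) := by
  have hcomp : qFun Y g ∘ polar = fun p : Sph d × Ioi (0 : ℝ) => g p.2 * Y p.1 :=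
    funext fun p => qFun_polar Y g p
  have hYm : AEStronglyMeasurable (Y : Sph d → ℂ) (surf d) := Y.continuous.aestronglyMeasurable
  have hm : AEStronglyMeasurable (qFun Y g ∘ polar) ((surf d).prod (radMeasure d)) := by
    rw [hcomp]
    exact (hg.comp_snd).mul (hYm.comp_fst)
  have hm' : AEStronglyMeasurable (qFun Y g) ((volume : Measure (E d)).restrict {0}ᶜ) :=
    ((measurePreserving_polar d).aestronglyMeasurable_comp_iff measurableEmbedding_polar).1 hm
  have hind : ({0}ᶜ : Set (E d)).indicator (qFun Y g) = qFun Y g := by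
    refine indicator_eq_self.2 fun x hx hx0 => hx ?_
    rw [mem_singleton_iff.1 hx0, qFun_zero_apply]
  refine ⟨?_, ?_⟩
  · rw [← hind]
    exact (aestronglyMeasurable_indicator_iff (measurableSet_singleton _).compl).2 hm'
  · have h1 : eLpNorm (qFun Y g) 2 (volume : Measure (E d))
        = eLpNorm (qFun Y g ∘ polar) 2 ((surf d).prod (radMeasure d)) := by
      rw [← hind, eLpNorm_indicator_eq_eLpNorm_restrict (measurableSet_singleton _).compl, hind]
      exact (eLpNorm_comp_measurePreserving hm' (measurePreserving_polar d)).symm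
    have h2 : eLpNorm (qFun Y g ∘ polar) 2 ((surf d).prod (radMeasure d)) ^ 2
        = eLpNorm g 2 (radMeasure d) ^ 2 := by
      rw [eLpNorm_two_sq, eLpNorm_two_sq, hcomp]
      have : ∀ p : Sph d × Ioi (0 : ℝ), ‖g p.2 * Y p.1‖ₑ ^ 2 = ‖Y p.1‖ₑ ^ 2 * ‖g p.2‖ₑ ^ 2 :=
        fun p => by rw [enorm_mul, mul_pow, mul_comm]
      simp_rw [this]
      rw [lintegral_prod_mul (hYm.enorm.pow_const 2) (hg.enorm.pow_const 2), Y.lintegral_sq,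
        one_mul]
    rw [h1]
    exact (ENNReal.pow_right_strictMono two_ne_zero).injective h2

theorem memLp_qFun {d ℓ : ℕ} (Y : SphericalHarmonic d ℓ) (g : L2rad d) :
    MemLp (qFun Y g) 2 (volume : Measure (E d)) := by
  have h := eLpNorm_qFun Y (Lp.aestronglyMeasurable g)
  exact ⟨h.1, h.2 ▸ (Lp.memLp g).2⟩

/-- The operator `Q : L²_rad(ℝ^d) → L²(ℝ^d)`, `[Q g](x) = g(|x|) Y(x/|x|)`. -/
def opQ {d ℓ : ℕ} (Y : SphericalHarmonic d ℓ) : L2rad d →L[ℂ] L2 d :=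
  LinearMap.mkContinuous
    { toFun := fun g => (memLp_qFun Y g).toLp (qFun Y g)
      map_add' := fun g h => by
        rw [← MemLp.toLp_add, MemLp.toLp_eq_toLp_iff]
        refine ae_eq_of_polar (by simp [qFun_zero_apply]) ?_
        have := Measure.quasiMeasurePreserving_snd (μ := surf d) (ν := radMeasure d)
          |>.ae_eq_comp (Lp.coeFn_add g h)
        filter_upwards [this] with p hp
        simp only [Function.comp_apply, Pi.add_apply, qFun_polar] at hp ⊢
        rw [hp, add_mul]
      map_smul' := fun c g => by
        rw [RingHom.id_apply, ← MemLp.toLp_const_smul, MemLp.toLp_eq_toLp_iff]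
        refine ae_eq_of_polar (by simp [qFun_zero_apply]) ?_
        have := Measure.quasiMeasurePreserving_snd (μ := surf d) (ν := radMeasure d)
          |>.ae_eq_comp (Lp.coeFn_smul c g)
        filter_upwards [this] with p hp
        simp only [Function.comp_apply, Pi.smul_apply, qFun_polar, smul_eq_mul] at hp ⊢
        rw [hp, mul_assoc] }
    1 fun g => by
      simp only [LinearMap.coe_mk, AddHom.coe_mk, one_mul]
      rw [Lp.norm_toLp, (eLpNorm_qFun Y (Lp.aestronglyMeasurable g)).2, Lp.norm_def]

theorem aestronglyMeasurable_comp_polar {d : ℕ} {f : E d → ℂ}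
    (hf : AEStronglyMeasurable f (volume : Measure (E d))) :
    AEStronglyMeasurable (f ∘ polar) ((surf d).prod (radMeasure d)) :=
  hf.restrict.comp_quasiMeasurePreserving (measurePreserving_polar d).quasiMeasurePreserving

theorem lintegral_slices {d : ℕ} {f : E d → ℂ}
    (hf : AEStronglyMeasurable f (volume : Measure (E d))) :
    ∫⁻ r, ∫⁻ ω, ‖f (polar (ω, r))‖ₑ ^ 2 ∂(surf d) ∂(radMeasure d)
      ≤ eLpNorm f 2 (volume : Measure (E d)) ^ 2 := by
  have hm := aestronglyMeasurable_comp_polar hf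
  have h1 := lintegral_prod_symm (μ := surf d) (ν := radMeasure d)
    (fun p => ‖(f ∘ polar) p‖ₑ ^ 2) (hm.enorm.pow_const 2)
  simp only [Function.comp_apply] at h1
  rw [← h1]
  have h2 := eLpNorm_comp_measurePreserving (p := 2) hf.restrict (measurePreserving_polar d)
  have h3 : ∫⁻ p, ‖f (polar p)‖ₑ ^ 2 ∂((surf d).prod (radMeasure d))
      = eLpNorm (f ∘ polar) 2 ((surf d).prod (radMeasure d)) ^ 2 := by
    rw [eLpNorm_two_sq]
    rfl
  rw [h3, h2]
  gcongr
  exact Measure.restrict_le_self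

/-- For almost every `r`, the restriction of `f` to the sphere of radius `r` is in `L²`. -/
theorem ae_memLp_slice {d : ℕ} {f : E d → ℂ} (hf : MemLp f 2 (volume : Measure (E d))) :
    ∀ᵐ r ∂(radMeasure d), MemLp (fun ω : Sph d => f (polar (ω, r))) 2 (surf d) := by
  have hm := aestronglyMeasurable_comp_polar hf.1
  have hlt : ∫⁻ r, ∫⁻ ω, ‖f (polar (ω, r))‖ₑ ^ 2 ∂(surf d) ∂(radMeasure d) ≠ ∞ :=
    ((lintegral_slices hf.1).trans_lt (ENNReal.pow_lt_top hf.2)).ne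
  have hme : AEMeasurable (fun r => ∫⁻ ω, ‖f (polar (ω, r))‖ₑ ^ 2 ∂(surf d)) (radMeasure d) :=
    (hm.prod_swap.enorm.pow_const 2).lintegral_prod_right'
  filter_upwards [ae_lt_top' hme hlt, hm.prod_swap.prodMk_left] with r hr hr'
  refine ⟨hr', ?_⟩
  by_contra hcon
  have htop := eLpNorm_two_sq (surf d) (fun ω : Sph d => f (polar (ω, r)))
  rw [not_lt_top_iff.1 hcon] at htop
  rw [← htop] at hr
  simp at hr

theorem SphericalHarmonic.memLp {d ℓ : ℕ} (Y : SphericalHarmonic d ℓ) :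
    MemLp (Y : Sph d → ℂ) 2 (surf d) :=
  Y.continuous.memLp_of_hasCompactSupport (HasCompactSupport.of_compactSpace _)

theorem ae_integrable_slice {d ℓ : ℕ} (Y : SphericalHarmonic d ℓ) {f : E d → ℂ}
    (hf : MemLp f 2 (volume : Measure (E d))) :
    ∀ᵐ r : Ioi (0 : ℝ) ∂(radMeasure d),
      Integrable (fun ω : Sph d => f ((r : ℝ) • (ω : E d)) * conj (Y ω)) (surf d) := by
  filter_upwards [ae_memLp_slice hf] with r hr
  exact hr.integrable_mul Y.memLp.star

theorem pFun_congr {d : ℕ} (Y : Sph d → ℂ) {f g : E d → ℂ} (h : f =ᵐ[volume] g) :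
    pFun Y f =ᵐ[radMeasure d] pFun Y g := by
  have h1 := ae_polar_of_ae_eq h
  have h2 : ∀ᵐ p ∂((radMeasure d).prod (surf d)), f (polar p.swap) = g (polar p.swap) :=
    Measure.measurePreserving_swap.quasiMeasurePreserving.ae h1
  filter_upwards [Measure.ae_ae_of_ae_prod h2] with r hr
  refine integral_congr_ae ?_
  filter_upwards [hr] with ω hω
  have : f ((r : ℝ) • (ω : E d)) = g ((r : ℝ) • (ω : E d)) := hω
  simp only [this]

theorem enorm_pFun_sq_le {d ℓ : ℕ} (Y : SphericalHarmonic d ℓ) (f : E d → ℂ) (r : Ioi (0 : ℝ))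
    (hr : AEStronglyMeasurable (fun ω : Sph d => f (polar (ω, r))) (surf d)) :
    ‖pFun Y f r‖ₑ ^ 2 ≤ ∫⁻ ω, ‖f (polar (ω, r))‖ₑ ^ 2 ∂(surf d) := by
  have h1 : ‖pFun Y f r‖ₑ ≤ ∫⁻ ω, ‖f (polar (ω, r))‖ₑ * ‖Y ω‖ₑ ∂(surf d) := by
    refine (enorm_integral_le_lintegral_enorm _).trans (lintegral_mono fun ω => ?_)
    rw [enorm_mul, RCLike.enorm_conj]
    rfl
  have h2 := ENNReal.lintegral_mul_le_Lp_mul_Lq (surf d) (p := 2) (q := 2)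
    (Real.HolderConjugate.two_two) hr.enorm Y.continuous.aestronglyMeasurable.enorm
  have h3 : ∫⁻ ω, ‖Y ω‖ₑ ^ (2 : ℝ) ∂(surf d) = 1 := by
    rw [← Y.lintegral_sq]
    simp
  rw [h3, ENNReal.one_rpow, mul_one] at h2
  calc ‖pFun Y f r‖ₑ ^ 2
      ≤ ((∫⁻ ω, ‖f (polar (ω, r))‖ₑ ^ (2 : ℝ) ∂(surf d)) ^ (1 / (2 : ℝ))) ^ 2 := by
        gcongr
        exact h1.trans h2
    _ = ∫⁻ ω, ‖f (polar (ω, r))‖ₑ ^ 2 ∂(surf d) := by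
        rw [← ENNReal.rpow_natCast, ← ENNReal.rpow_mul]
        simp

theorem eLpNorm_pFun {d ℓ : ℕ} (Y : SphericalHarmonic d ℓ) {f : E d → ℂ}
    (hf : MemLp f 2 (volume : Measure (E d))) :
    AEStronglyMeasurable (pFun Y f) (radMeasure d) ∧
      eLpNorm (pFun Y f) 2 (radMeasure d) ≤ eLpNorm f 2 (volume : Measure (E d)) := by
  have hm := aestronglyMeasurable_comp_polar hf.1
  refine ⟨?_, ?_⟩
  · have hY : AEStronglyMeasurable (fun p : Ioi (0 : ℝ) × Sph d => conj (Y p.2))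
        ((radMeasure d).prod (surf d)) :=
      (RCLike.continuous_conj.comp (Y.continuous.comp continuous_snd)).aestronglyMeasurable
    exact (hm.prod_swap.mul hY).integral_prod_right'
  · have h : eLpNorm (pFun Y f) 2 (radMeasure d) ^ 2
        ≤ eLpNorm f 2 (volume : Measure (E d)) ^ 2 := by
      rw [eLpNorm_two_sq]
      refine le_trans (lintegral_mono_ae ?_) (lintegral_slices hf.1)
      filter_upwards [hm.prod_swap.prodMk_left] with r hr
      exact enorm_pFun_sq_le Y f r hr
    exact (ENNReal.pow_le_pow_left_iff two_ne_zero).1 h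

theorem memLp_pFun {d ℓ : ℕ} (Y : SphericalHarmonic d ℓ) (f : L2 d) :
    MemLp (pFun Y f) 2 (radMeasure d) :=
  ⟨(eLpNorm_pFun Y (Lp.memLp f)).1, (eLpNorm_pFun Y (Lp.memLp f)).2.trans_lt (Lp.memLp f).2⟩

/-- The operator `P : L²(ℝ^d) → L²_rad(ℝ^d)`, `[P f](r) = ∫ f(rω) conj(Y(ω)) dσ(ω)`. -/
def opP {d ℓ : ℕ} (Y : SphericalHarmonic d ℓ) : L2 d →L[ℂ] L2rad d :=
  LinearMap.mkContinuous
    { toFun := fun f => (memLp_pFun Y f).toLp (pFun Y f)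
      map_add' := fun f g => by
        rw [← MemLp.toLp_add, MemLp.toLp_eq_toLp_iff]
        filter_upwards [pFun_congr Y (Lp.coeFn_add f g), ae_integrable_slice Y (Lp.memLp f),
          ae_integrable_slice Y (Lp.memLp g)] with r hr hf hg
        rw [hr, Pi.add_apply]
        simp only [pFun, Pi.add_apply, add_mul]
        exact integral_add hf hg
      map_smul' := fun c f => by
        rw [RingHom.id_apply, ← MemLp.toLp_const_smul, MemLp.toLp_eq_toLp_iff]
        filter_upwards [pFun_congr Y (Lp.coeFn_smul c f)] with r hr
        rw [hr, Pi.smul_apply]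
        simp only [pFun, Pi.smul_apply, smul_eq_mul, mul_assoc]
        exact integral_const_mul c _ }
    1 fun f => by
      simp only [LinearMap.coe_mk, AddHom.coe_mk, one_mul]
      rw [Lp.norm_toLp, Lp.norm_def]
      exact ENNReal.toReal_mono (Lp.memLp f).2.ne (eLpNorm_pFun Y (Lp.memLp f)).2

/-- The reduced resolvent `P R(z) Q` on `L²_rad(ℝ^d)`, where `R(z) = (z - L)⁻¹`. -/
def reducedResolvent {d ℓ : ℕ} (V : ℝ → ℂ) (Y : SphericalHarmonic d ℓ) (z : ℂ) :
    L2rad d →L[ℂ] L2rad d :=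
  (opP Y).comp ((resolvent (op d V) z).comp (opQ Y))

end OrnsteinUhlenbeck

end

noncomputable section

namespace OrnsteinUhlenbeck

open MeasureTheory Set Metric Filter
open scoped ENNReal ComplexConjugate Topology FourierTransform

/-! The reduced resolvents inherit their bound from the full resolvent: by the normalization of the
spherical harmonics, both angular maps are contractions (`norm_opP_le`, `norm_opQ_le`). It therefore
suffices to bound the resolvent on `L²(ℝ^d)`, and uniformity in the degree and in the harmonic is
automatic.

Let `F = z u - Δu + 2 x · ∇u` with `Re z = d + b`. Formally, pairing `F` with `u` and taking real
parts gives `b ‖u‖² + ‖∇u‖² = Re ⟨F, u⟩`, since the drift contributes `-d ‖u‖²`. Hence `b ‖u‖ ≤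
‖F‖`, and the gradient is controlled as well (`IsSobolev.energy_le`). For `u` in `H²` the pairing
with the unbounded drift need not be integrable, so the identity is derived with the weight `(1 +
ε|x|²)⁻¹` and `ε → 0`. Taking imaginary parts with the weight for `ε = 1`, which is `⟨x⟩⁻²`, bounds
`Im z ∫ ⟨x⟩⁻² |u|²` by a multiple of `‖F‖²`. As `|V| ≤ K ⟨x⟩⁻²`, the norm of `V u` is at most `‖F‖ /
2` for large `Im z`: the potential is a relatively small perturbation.

The a priori bound must be complemented by density of the range. For the free operator, a function
`g` orthogonal to the range is tested against Gaussian wave packets, whose evolution is explicit.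
The pairing `H(t)` solves `H' = z H` but grows at most like `e^{dt}`, so it vanishes because `Re z >
d`. Injectivity of the Fourier transform then gives `g = 0` (`ae_eq_zero_of_orthogonal_gauss`).
Density survives the perturbation by Riesz's lemma (`dense_range_of_perturbation`), and the bound
and density together produce the resolvent of the closure (`exists_isResolventAt_closure`). -/

/-! ### Closures of dissipative operators and their resolvents -/

section Abstract

variable {X : Type*} [NormedAddCommGroup X] [NormedSpace ℂ X]

/-- A property of pairs `(u, A u)` that is closed extends to the closure of the graph. -/
theorem mem_of_mem_graph_topologicalClosure {A : X →ₗ.[ℂ] X} {S : Set (X × X)} (hS : IsClosed S)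
    (h : ∀ u : A.domain, ((u : X), A u) ∈ S) {p : X × X} (hp : p ∈ A.graph.topologicalClosure) :
    p ∈ S := by
  have hsub : (A.graph : Set (X × X)) ⊆ S := by
    rintro ⟨x, y⟩ hxy
    obtain ⟨u, hu, hv⟩ := (LinearPMap.mem_graph_iff A).1 hxy
    simp only at hu hv
    subst hu hv
    exact h u
  exact closure_minimal hsub hS hp

/-- The Lumer–Phillips argument. If `(0, y)` is a limit of points `(uₙ, A uₙ)`, the estimate for `uₙ
+ μ⁻¹ v` passes to the limit; letting `μ → ∞` leaves `‖v‖ ≤ ‖v - y‖` for all `v` in the domain. By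
density `v` may tend to `y`, whence `y = 0`. -/
theorem isClosable_of_dissipative {A : X →ₗ.[ℂ] X} (hd : Dense (A.domain : Set X)) (c : ℝ)
    (h : ∀ μ : ℝ, c < μ → ∀ u : A.domain, (μ - c) * ‖(u : X)‖ ≤ ‖(μ : ℂ) • (u : X) - A u‖) :
    A.IsClosable := by
  have key : ∀ p ∈ A.graph.topologicalClosure, p.1 = 0 → p.2 = 0 := by
    rintro ⟨x, y⟩ hp (rfl : x = 0)
    have step1 : ∀ (v : A.domain) (μ : ℝ), c < μ → 0 < μ →
        (μ - c) * ‖μ⁻¹ • (v : X)‖ ≤ ‖(v : X) - μ⁻¹ • A v - y‖ := by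
      intro v μ hc hμ
      have := mem_of_mem_graph_topologicalClosure
        (S := {p : X × X | (μ - c) * ‖p.1 + μ⁻¹ • (v : X)‖
          ≤ ‖(μ : ℂ) • p.1 + v - μ⁻¹ • A v - p.2‖})
        (isClosed_le (by fun_prop) (by fun_prop)) (fun u => ?_) hp
      · simpa using this
      · have h1 := h μ hc (u + ((μ⁻¹ : ℝ) : ℂ) • v)
        rw [LinearPMap.map_add, LinearPMap.map_smul] at h1
        have e1 : ((u + ((μ⁻¹ : ℝ) : ℂ) • v : A.domain) : X) = u + μ⁻¹ • (v : X) := by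
          rw [Submodule.coe_add, Submodule.coe_smul, Complex.coe_smul]
        have e2 : (μ : ℂ) • ((u : X) + μ⁻¹ • (v : X)) - (A u + ((μ⁻¹ : ℝ) : ℂ) • A v)
            = (μ : ℂ) • (u : X) + v - μ⁻¹ • A v - A u := by
          have : (μ : ℂ) • (μ⁻¹ • (v : X)) = v := by
            rw [Complex.coe_smul, smul_smul, mul_inv_cancel₀ hμ.ne', one_smul]
          rw [smul_add, this, Complex.coe_smul μ⁻¹]
          abel
        rw [e1, e2] at h1
        exact h1
    have step2 : ∀ v : A.domain, ‖(v : X)‖ ≤ ‖(v : X) - y‖ := by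
      intro v
      have hinv : Tendsto (fun μ : ℝ => μ⁻¹) atTop (𝓝 0) := tendsto_inv_atTop_zero
      have l1 : Tendsto (fun μ : ℝ => (1 - c * μ⁻¹) * ‖(v : X)‖) atTop
          (𝓝 ((1 - c * 0) * ‖(v : X)‖)) := ((hinv.const_mul c).const_sub 1).mul_const _
      have l2 : Tendsto (fun μ : ℝ => ‖(v : X) - μ⁻¹ • A v - y‖) atTop
          (𝓝 ‖(v : X) - (0 : ℝ) • A v - y‖) :=
        (((hinv.smul_const (A v)).const_sub _).sub_const _).norm
      have := le_of_tendsto_of_tendsto l1 l2 (by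
        filter_upwards [eventually_gt_atTop c, eventually_gt_atTop 0] with μ h1 h2
        refine le_trans (le_of_eq ?_) (step1 v μ h1 h2)
        rw [norm_smul, Real.norm_of_nonneg (inv_pos.2 h2).le]
        field_simp)
      simpa using this
    have step3 : ‖y‖ ≤ ‖y - y‖ := by
      have hcl : IsClosed {v : X | ‖v‖ ≤ ‖v - y‖} := isClosed_le (by fun_prop) (by fun_prop)
      exact closure_minimal (fun v hv => step2 ⟨v, hv⟩) hcl (hd y)
    simpa using step3
  refine ⟨A.graph.topologicalClosure.toLinearPMap, ?_⟩
  rw [Submodule.toLinearPMap_graph_eq _ key]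

/-- The a priori bound is a closed condition, so it extends to the closed graph. There `(u, v) ↦ z u
- v` is bounded below in the graph norm, hence injective with closed range, and the range is dense.
The resolvent is the first component of the inverse. -/
theorem exists_isResolventAt_closure [CompleteSpace X] {A : X →ₗ.[ℂ] X} (hA : A.IsClosable) {z : ℂ}
    {C : ℝ} (hC : 0 ≤ C) (h : ∀ u : A.domain, ‖(u : X)‖ ≤ C * ‖z • (u : X) - A u‖)
    (hr : Dense (range fun u : A.domain => z • (u : X) - A u)) :
    ∃ R : X →L[ℂ] X, IsResolventAt A.closure z R ∧ ‖R‖ ≤ C := by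
  set G : Submodule ℂ (X × X) := A.closure.graph with hG
  have hGc : A.graph.topologicalClosure = G := hA.graph_closure_eq_closure_graph
  have hGclosed : IsClosed (G : Set (X × X)) := by
    rw [← hGc]
    exact A.graph.isClosed_topologicalClosure
  have hb : ∀ p ∈ G, ‖p.1‖ ≤ C * ‖z • p.1 - p.2‖ := by
    intro p hp
    rw [← hGc] at hp
    exact mem_of_mem_graph_topologicalClosure
      (S := {p : X × X | ‖p.1‖ ≤ C * ‖z • p.1 - p.2‖})
      (isClosed_le (by fun_prop) (by fun_prop)) h hp
  let T : G →L[ℂ] X :=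
    (z • ContinuousLinearMap.fst ℂ X X - ContinuousLinearMap.snd ℂ X X).comp G.subtypeL
  have hT : ∀ p : G, T p = z • (p : X × X).1 - (p : X × X).2 := fun p => rfl
  have hanti : AntilipschitzWith (Real.toNNReal (C + ‖z‖ * C + 1)) T := by
    refine ContinuousLinearMap.antilipschitz_of_bound T fun p => ?_
    rw [Real.coe_toNNReal _ (by positivity), hT]
    have h1 := hb p p.2
    have hn : 0 ≤ ‖z • (p : X × X).1 - (p : X × X).2‖ := norm_nonneg _
    have h2 : ‖(p : X × X).2‖ ≤ ‖z‖ * ‖(p : X × X).1‖ + ‖z • (p : X × X).1 - (p : X × X).2‖ := by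
      rw [← norm_smul]
      calc ‖(p : X × X).2‖ = ‖z • (p : X × X).1 - (z • (p : X × X).1 - (p : X × X).2)‖ := by
            rw [sub_sub_cancel]
        _ ≤ _ := norm_sub_le _ _
    have h3 : ‖z‖ * ‖(p : X × X).1‖ ≤ ‖z‖ * (C * ‖z • (p : X × X).1 - (p : X × X).2‖) :=
      mul_le_mul_of_nonneg_left h1 (norm_nonneg z)
    have h4 : 0 ≤ C * ‖z • (p : X × X).1 - (p : X × X).2‖ := by positivity
    have h5 : 0 ≤ ‖z‖ * (C * ‖z • (p : X × X).1 - (p : X × X).2‖) := by positivity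
    change ‖(p : X × X)‖ ≤ _
    rw [Prod.norm_def]
    refine max_le ?_ ?_ <;> nlinarith
  have : CompleteSpace G := hGclosed.completeSpace_coe
  have hcr : IsClosed (range T) := hanti.isClosed_range T.uniformContinuous
  have hsurj : Function.Surjective T := by
    refine range_eq_univ.1 (hcr.closure_eq ▸ ?_)
    refine Dense.closure_eq (hr.mono ?_)
    rintro _ ⟨u, rfl⟩
    have hu : ((u : X), A u) ∈ G := by
      rw [← hGc]
      exact A.graph.le_topologicalClosure (A.mem_graph u)
    exact ⟨⟨_, hu⟩, rfl⟩
  let e : G ≃ₗ[ℂ] X := LinearEquiv.ofBijective (T : G →ₗ[ℂ] X) ⟨hanti.injective, hsurj⟩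
  have he : ∀ p : G, e p = z • (p : X × X).1 - (p : X × X).2 := fun p => rfl
  let R : X →L[ℂ] X := LinearMap.mkContinuous
    ((LinearMap.fst ℂ X X).comp (G.subtype.comp (e.symm : X →ₗ[ℂ] G))) C fun f => by
      have := hb (e.symm f) (e.symm f).2
      rwa [← he, e.apply_symm_apply] at this
  have hR : ∀ f, R f = (e.symm f : X × X).1 := fun f => rfl
  refine ⟨R, ⟨fun f => ?_, fun u => ?_⟩, LinearMap.mkContinuous_norm_le _ hC _⟩
  · obtain ⟨v, hv1, hv2⟩ := (LinearPMap.mem_graph_iff _).1 (e.symm f).2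
    have hRv : (v : X) = R f := hv1
    refine ⟨hRv ▸ v.2, ?_⟩
    have : (⟨R f, hRv ▸ v.2⟩ : A.closure.domain) = v := Subtype.ext hRv.symm
    rw [this, hv2, hR, ← he, e.apply_symm_apply]
  · rw [hR]
    have : z • (u : X) - A.closure u = e ⟨((u : X), A.closure u), A.closure.mem_graph u⟩ := rfl
    rw [this, e.symm_apply_apply]

/-- The range of `z - A` stays dense under a relatively small perturbation of `A`. -/
theorem dense_range_of_perturbation {A : X →ₗ.[ℂ] X} {A' : A.domain → X} {z : ℂ} {q : ℝ}
    (hq : q < 1) (hq0 : 0 ≤ q)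
    (hB : ∀ u : A.domain, ‖A u - A' u‖ ≤ q * ‖z • (u : X) - A' u‖)
    (hr : Dense (range fun u : A.domain => z • (u : X) - A' u)) :
    Dense (range fun u : A.domain => z • (u : X) - A u) := by
  let M : Submodule ℂ X := (LinearMap.range (z • A.domain.subtype - A.toFun)).topologicalClosure
  have hM : ∀ u : A.domain, z • (u : X) - A u ∈ M := fun u =>
    Submodule.le_topologicalClosure _ ⟨u, rfl⟩
  have hMtop : ∀ x, x ∈ M := by
    by_contra! hne
    -- Riesz's lemma gives `y` at distance at least `r ‖y‖` from `M`, with `q < r < 1`. If `z u - A'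
    -- u` is `δ`-close to `y`, then `z u - A u` is within `q (‖y‖ + δ) + δ` of `y`, and `δ` is
    -- chosen to make this less than `r ‖y‖`.
    obtain ⟨r, hqr, hr1⟩ := exists_between hq
    obtain ⟨y, hyM, hy⟩ := riesz_lemma (Submodule.isClosed_topologicalClosure _) hne hr1
    have hy0 : 0 < ‖y‖ := norm_pos_iff.2 fun h0 => hyM (h0 ▸ M.zero_mem)
    obtain ⟨δ, hδ, hδ1⟩ : ∃ δ : ℝ, 0 < δ ∧ δ * (1 + q) < (r - q) * ‖y‖ := by
      refine ⟨(r - q) * ‖y‖ / (2 * (1 + q)), ?_, ?_⟩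
      · have := sub_pos.2 hqr
        positivity
      · have : 0 < (r - q) * ‖y‖ := mul_pos (sub_pos.2 hqr) hy0
        field_simp
        linarith
    obtain ⟨_, hu, ⟨u, rfl⟩⟩ := Metric.dense_iff.1 hr y δ hδ
    rw [Metric.mem_ball, dist_eq_norm] at hu
    simp only at hu
    have h1 := hy _ (hM u)
    have h2 : y - (z • (u : X) - A u) = (A u - A' u) - ((z • (u : X) - A' u) - y) := by abel
    have h3 : ‖z • (u : X) - A' u‖ ≤ ‖y‖ + δ := by
      calc ‖z • (u : X) - A' u‖ = ‖y + ((z • (u : X) - A' u) - y)‖ := by rw [add_sub_cancel]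
        _ ≤ _ := (norm_add_le _ _).trans (by linarith)
    rw [h2] at h1
    have h4 := (h1.trans (norm_sub_le _ _)).trans (add_le_add (hB u) hu.le)
    nlinarith [mul_le_mul_of_nonneg_left h3 hq0]
  intro x
  exact hMtop x

end Abstract

/-! ### Weighted energy identities -/

/-- The weight `(1 + ε |x|²)⁻¹`. -/
def weight {d : ℕ} (ε : ℝ) (x : E d) : ℝ := (1 + ε * ‖x‖ ^ 2)⁻¹

section Weight

variable {d : ℕ} {ε : ℝ}

theorem one_add_mul_norm_sq_pos (hε : 0 ≤ ε) (x : E d) : 0 < 1 + ε * ‖x‖ ^ 2 := by positivity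

theorem weight_pos (hε : 0 ≤ ε) (x : E d) : 0 < weight ε x :=
  inv_pos.2 (one_add_mul_norm_sq_pos hε x)

theorem weight_le_one (hε : 0 ≤ ε) (x : E d) : weight ε x ≤ 1 :=
  inv_le_one_of_one_le₀ (le_add_of_nonneg_right (by positivity))

theorem continuous_weight (hε : 0 ≤ ε) : Continuous (weight ε : E d → ℝ) :=
  Continuous.inv₀ (by fun_prop) fun x => (one_add_mul_norm_sq_pos hε x).ne'

/-- The inequality `2 s ≤ 1 + s²` for `s = √ε |x|`. It lets one factor of the weight absorb the
growth of the drift at the cost of `ε^{-1/2}`. -/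
theorem two_mul_sqrt_mul_norm_mul_weight_le (hε : 0 ≤ ε) (x : E d) :
    2 * √ε * ‖x‖ * weight ε x ≤ 1 := by
  rw [weight, ← div_eq_mul_inv, div_le_one (one_add_mul_norm_sq_pos hε x)]
  nlinarith [sq_nonneg (√ε * ‖x‖ - 1), Real.sq_sqrt hε]

theorem hasFDerivAt_weight (hε : 0 ≤ ε) (x : E d) :
    HasFDerivAt (weight ε : E d → ℝ)
      ((-(2 * ε * weight ε x ^ 2)) • (innerSL ℝ x)) x := by
  have h1 : HasFDerivAt (fun y : E d => 1 + ε * ‖y‖ ^ 2) (ε • (2 • innerSL ℝ x)) x :=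
    ((hasStrictFDerivAt_norm_sq x).hasFDerivAt.const_mul ε).const_add 1
  have h2 := (hasDerivAt_inv (one_add_mul_norm_sq_pos hε x).ne').comp_hasFDerivAt x h1
  refine h2.congr_fderiv ?_
  ext v
  simp [weight]
  ring

end Weight

/-! ### Divergence identities for the weighted fields. -/

section Derivatives

variable {d : ℕ}

/-- The standard basis vectors of `ℝ^d`. -/
abbrev stdVec (j : Fin d) : E d := EuclideanSpace.single j 1

theorem sum_coord_smul_stdVec (x : E d) : ∑ j, x j • stdVec j = x := by
  have := (EuclideanSpace.basisFun (Fin d) ℝ).sum_repr x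
  simpa using this

theorem sum_coord_mul_fderiv (u : E d → ℂ) (x v : E d) :
    ∑ j, (v j : ℂ) * fderiv ℝ u x (stdVec j) = fderiv ℝ u x v := by
  conv_rhs => rw [← sum_coord_smul_stdVec v]
  simp [map_sum]

theorem norm_sq_eq_sum (x : E d) : ‖x‖ ^ 2 = ∑ j, x j ^ 2 := by
  simp [EuclideanSpace.norm_sq_eq]

/-- The square of the norm of the gradient. -/
def gradSq (u : E d → ℂ) (x : E d) : ℝ := ∑ j, ‖fderiv ℝ u x (stdVec j)‖ ^ 2

theorem gradSq_nonneg (u : E d → ℂ) (x : E d) : 0 ≤ gradSq u x :=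
  Finset.sum_nonneg fun _ _ => by positivity

theorem norm_fderiv_apply_le (u : E d → ℂ) (x v : E d) :
    ‖fderiv ℝ u x v‖ ≤ ‖v‖ * √(gradSq u x) := by
  rw [← sum_coord_mul_fderiv]
  refine (norm_sum_le _ _).trans ?_
  simp only [norm_mul, Complex.norm_real]
  refine (Real.sum_mul_le_sqrt_mul_sqrt _ _ _).trans (le_of_eq ?_)
  rw [EuclideanSpace.norm_eq, gradSq]

theorem laplacian_eq_sum {u : E d → ℂ} (hu : ContDiff ℝ 2 u) (x : E d) :
    Laplacian.laplacian u x
      = ∑ j, fderiv ℝ (fun y => fderiv ℝ u y (stdVec j)) x (stdVec j) := by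
  rw [InnerProductSpace.laplacian_eq_iteratedFDeriv_orthonormalBasis u
    (EuclideanSpace.basisFun (Fin d) ℝ)]
  refine Finset.sum_congr rfl fun j _ => ?_
  have h : DifferentiableAt ℝ (fderiv ℝ u) x :=
    ((hu.fderiv_right (m := 1) (by norm_num)).differentiable (by norm_num)) x
  rw [iteratedFDeriv_two_apply, fderiv_clm_apply h (differentiableAt_const _)]
  simp

theorem integrable_bdd_mul_mul_conj {m f g : E d → ℂ} {C : ℝ} (hm : Continuous m)
    (hC : ∀ x, ‖m x‖ ≤ C) (hf : MemLp f 2 (volume : Measure (E d)))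
    (hg : MemLp g 2 (volume : Measure (E d))) :
    Integrable (fun x => m x * (f x * conj (g x))) := by
  have h : Integrable (fun x => f x * conj (g x)) := hf.integrable_mul hg.star
  exact h.bdd_mul hm.aestronglyMeasurable (ae_of_all _ hC)

theorem integral_fderiv_eq_zero {G : E d → ℂ} {v : E d} (hG : Differentiable ℝ G)
    (hi : Integrable G) (hi' : Integrable fun x => fderiv ℝ G x v) :
    ∫ x, fderiv ℝ G x v = 0 := by
  have := integral_mul_fderiv_eq_neg_fderiv_mul_of_integrable (μ := (volume : Measure (E d)))
    (f := fun _ => (1 : ℂ)) (g := G) (v := v) (by simp) (by simpa using hi') (by simpa using hi)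
    (fun x _ => differentiableAt_const _) (fun x _ => hG x)
  simpa using this

/-- The divergence of `(1 + ε |x|²)⁻¹ ū ∇u`. -/
def divGrad (ε : ℝ) (u : E d → ℂ) (x : E d) : ℂ :=
  weight ε x * (Laplacian.laplacian u x * conj (u x)) + weight ε x * gradSq u x
    - 2 * ε * weight ε x ^ 2 * (fderiv ℝ u x x * conj (u x))

/-- The divergence of `(1 + ε |x|²)⁻¹ |u|² x`. -/
def divRadial (ε : ℝ) (u : E d → ℂ) (x : E d) : ℂ :=
  (d * weight ε x - 2 * ε * ‖x‖ ^ 2 * weight ε x ^ 2) * (u x * conj (u x))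
    + weight ε x * (fderiv ℝ u x x * conj (u x) + u x * conj (fderiv ℝ u x x))

variable {ε : ℝ} {u : E d → ℂ}

theorem abs_coord_le_norm (x : E d) (j : Fin d) : |x j| ≤ ‖x‖ := by
  simpa using PiLp.norm_apply_le x j

theorem abs_coord_mul_weight_le (hε : 0 < ε) (x : E d) (j : Fin d) :
    |x j| * weight ε x ≤ (√ε)⁻¹ := by
  have h1 := two_mul_sqrt_mul_norm_mul_weight_le hε.le x
  have h2 := weight_pos hε.le x
  have h3 : 0 < √ε := Real.sqrt_pos.2 hε
  have h4 : |x j| * weight ε x ≤ ‖x‖ * weight ε x :=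
    mul_le_mul_of_nonneg_right (abs_coord_le_norm x j) h2.le
  rw [inv_eq_one_div, le_div_iff₀ h3]
  have h5 : 0 ≤ ‖x‖ * weight ε x := by positivity
  nlinarith

theorem hasFDerivAt_ofReal_weight (hε : 0 ≤ ε) (x : E d) :
    HasFDerivAt (fun y : E d => (weight ε y : ℂ))
      (Complex.ofRealCLM.comp ((-(2 * ε * weight ε x ^ 2)) • (innerSL ℝ x))) x :=
  Complex.ofRealCLM.hasFDerivAt.comp x (hasFDerivAt_weight hε x)

theorem fderiv_weight_mul_mul_conj (hε : 0 ≤ ε) {f g : E d → ℂ} {x : E d}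
    (hf : DifferentiableAt ℝ f x) (hg : DifferentiableAt ℝ g x) (j : Fin d) :
    DifferentiableAt ℝ (fun y => (weight ε y : ℂ) * (f y * conj (g y))) x ∧
    fderiv ℝ (fun y => (weight ε y : ℂ) * (f y * conj (g y))) x (stdVec j)
      = weight ε x * (fderiv ℝ f x (stdVec j) * conj (g x))
        + weight ε x * (f x * conj (fderiv ℝ g x (stdVec j)))
        - 2 * ε * (weight ε x ^ 2 * x j) * (f x * conj (g x)) := by
  have hg' : HasFDerivAt (fun y => conj (g y))
      ((Complex.conjCLE : ℂ →L[ℝ] ℂ).comp (fderiv ℝ g x)) x :=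
    (Complex.conjCLE : ℂ →L[ℝ] ℂ).hasFDerivAt.comp x hg.hasFDerivAt
  have h := (hasFDerivAt_ofReal_weight hε x).mul (hf.hasFDerivAt.mul hg')
  refine ⟨h.differentiableAt, ?_⟩
  have e := h.fderiv
  simp only [Pi.mul_def] at e
  rw [e]
  simp [EuclideanSpace.inner_single_right]
  ring

/-- The assumptions on `u` in the energy estimates. -/
structure IsSobolev (u : E d → ℂ) : Prop where
  smooth : ContDiff ℝ 2 u
  memLp : MemLp u 2 (volume : Measure (E d))
  memLp_fderiv : ∀ j, MemLp (fun x => fderiv ℝ u x (stdVec j)) 2 (volume : Measure (E d))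
  memLp_fderiv_fderiv : ∀ j, MemLp
    (fun x => fderiv ℝ (fun y => fderiv ℝ u y (stdVec j)) x (stdVec j)) 2 (volume : Measure (E d))

theorem IsSobolev.differentiable (hu : IsSobolev u) : Differentiable ℝ u :=
  hu.smooth.differentiable (by norm_num)

theorem IsSobolev.differentiable_fderiv (hu : IsSobolev u) (j : Fin d) :
    Differentiable ℝ (fun x => fderiv ℝ u x (stdVec j)) :=
  ((hu.smooth.fderiv_right (m := 1) (by norm_num)).differentiable (by norm_num)).clm_apply
    (differentiable_const _)

theorem continuous_ofReal_weight (hε : 0 ≤ ε) : Continuous fun x : E d => (weight ε x : ℂ) :=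
  Complex.continuous_ofReal.comp (continuous_weight hε)

theorem norm_ofReal_weight_le (hε : 0 ≤ ε) (x : E d) : ‖(weight ε x : ℂ)‖ ≤ 1 := by
  rw [Complex.norm_real, Real.norm_of_nonneg (weight_pos hε x).le]
  exact weight_le_one hε x

theorem norm_weight_mul_coord_le (hε : 0 < ε) (x : E d) (j : Fin d) :
    ‖(weight ε x : ℂ) * x j‖ ≤ (√ε)⁻¹ := by
  rw [norm_mul, Complex.norm_real, Complex.norm_real, Real.norm_of_nonneg (weight_pos hε.le x).le,
    mul_comm]
  exact abs_coord_mul_weight_le hε x j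

/-- Each component of the field and each term of its divergence is a bounded multiplier times a
product of two `L²` functions, so the integral of the divergence vanishes without any compact
support. Positivity of `ε` bounds the factor `x j * weight ε x`. -/
theorem IsSobolev.integral_divGrad (hu : IsSobolev u) (hε : 0 < ε) :
    Integrable (divGrad ε u) ∧ ∫ x, divGrad ε u x = 0 := by
  have hw := continuous_ofReal_weight (d := d) hε.le
  have e : divGrad ε u = fun x => ∑ j, fderiv ℝ
      (fun y => (weight ε y : ℂ) * (fderiv ℝ u y (stdVec j) * conj (u y))) x (stdVec j) := by
    funext x
    rw [divGrad, laplacian_eq_sum hu.smooth, ← sum_coord_mul_fderiv u x x, gradSq]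
    push_cast
    simp only [Finset.sum_mul, Finset.mul_sum, ← Finset.sum_add_distrib, ← Finset.sum_sub_distrib]
    refine Finset.sum_congr rfl fun j _ => ?_
    rw [(fderiv_weight_mul_mul_conj hε.le (hu.differentiable_fderiv j x)
      (hu.differentiable x) j).2, ← Complex.mul_conj']
    ring
  have hi : ∀ j, Integrable fun x => fderiv ℝ
      (fun y => (weight ε y : ℂ) * (fderiv ℝ u y (stdVec j) * conj (u y))) x (stdVec j) := by
    intro j
    have h1 := integrable_bdd_mul_mul_conj hw (norm_ofReal_weight_le hε.le)
      (hu.memLp_fderiv_fderiv j) hu.memLp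
    have h2 := integrable_bdd_mul_mul_conj hw (norm_ofReal_weight_le hε.le)
      (hu.memLp_fderiv j) (hu.memLp_fderiv j)
    have h3 := integrable_bdd_mul_mul_conj (m := fun x : E d => 2 * ε * (weight ε x ^ 2 * x j))
      (C := 2 * ε * (√ε)⁻¹) (by fun_prop) (fun x => by
        have h1 := norm_weight_mul_coord_le hε x j
        have h2 := norm_ofReal_weight_le hε.le x
        have h3 : (2 * ε * ((weight ε x : ℂ) ^ 2 * x j))
          = ((2 * ε : ℝ) : ℂ) * (weight ε x * (weight ε x * x j)) := by push_cast; ring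
        rw [h3, norm_mul, Complex.norm_real, Real.norm_of_nonneg (by positivity), norm_mul]
        gcongr
        calc _ ≤ 1 * (√ε)⁻¹ := by gcongr
          _ = _ := one_mul _)
      (hu.memLp_fderiv j) hu.memLp
    refine ((h1.add h2).sub h3).congr (ae_of_all _ fun x => ?_)
    simp only
    rw [(fderiv_weight_mul_mul_conj hε.le (hu.differentiable_fderiv j x)
      (hu.differentiable x) j).2]
    rfl
  rw [e]
  refine ⟨integrable_finsetSum _ fun j _ => hi j, ?_⟩
  rw [integral_finsetSum _ fun j _ => hi j]
  refine Finset.sum_eq_zero fun j _ => integral_fderiv_eq_zero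
    (fun x => (fderiv_weight_mul_mul_conj hε.le (hu.differentiable_fderiv j x)
      (hu.differentiable x) j).1) ?_ (hi j)
  exact integrable_bdd_mul_mul_conj hw (norm_ofReal_weight_le hε.le) (hu.memLp_fderiv j) hu.memLp

/-- The field grows like `|x| |u|²` without the weight. Each derivative term carries at most one `x
j` per factor of the weight, so all multipliers stay bounded when `ε > 0`. -/
theorem IsSobolev.integral_divRadial (hu : IsSobolev u) (hε : 0 < ε) :
    Integrable (divRadial ε u) ∧ ∫ x, divRadial ε u x = 0 := by
  have hw := continuous_ofReal_weight (d := d) hε.le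
  have hc : ∀ j : Fin d, Differentiable ℝ (fun y : E d => (y j : ℂ)) := fun j =>
    (Complex.ofRealCLM.comp (EuclideanSpace.proj j : E d →L[ℝ] ℝ)).differentiable
  have hcd : ∀ (j : Fin d) (x : E d), fderiv ℝ (fun y : E d => (y j : ℂ)) x (stdVec j) = 1 := by
    intro j x
    have := (Complex.ofRealCLM.comp (EuclideanSpace.proj j : E d →L[ℝ] ℝ)).hasFDerivAt (x := x)
    have h2 : fderiv ℝ (fun y : E d => (y j : ℂ)) x = _ := this.fderiv
    rw [h2]
    simp
  have hd1 : ∀ j, Differentiable ℝ (fun y : E d => (y j : ℂ) * u y) := fun j =>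
    (hc j).mul hu.differentiable
  have hd2 : ∀ (j : Fin d) (x : E d), fderiv ℝ (fun y : E d => (y j : ℂ) * u y) x (stdVec j)
      = u x + x j * fderiv ℝ u x (stdVec j) := by
    intro j x
    have h := ((hc j x).hasFDerivAt.mul (hu.differentiable x).hasFDerivAt).fderiv
    simp only [Pi.mul_def] at h
    rw [h]
    simp [hcd]
    ring
  have e : divRadial ε u = fun x => ∑ j, fderiv ℝ
      (fun y => (weight ε y : ℂ) * ((y j * u y) * conj (u y))) x (stdVec j) := by
    funext x
    have hsum : ∀ j : Fin d, fderiv ℝ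
        (fun y => (weight ε y : ℂ) * ((y j * u y) * conj (u y))) x (stdVec j)
        = weight ε x * (u x * conj (u x))
          - ((x j : ℝ) ^ 2 : ℝ) * (2 * ε * weight ε x ^ 2 * (u x * conj (u x)))
          + (x j * fderiv ℝ u x (stdVec j)) * (weight ε x * conj (u x))
          + conj (x j * fderiv ℝ u x (stdVec j)) * (weight ε x * u x) := by
      intro j
      rw [(fderiv_weight_mul_mul_conj hε.le (hd1 j x) (hu.differentiable x) j).2, hd2]
      simp only [map_mul, Complex.conj_ofReal]
      push_cast
      ring
    simp only [hsum, Finset.sum_add_distrib, Finset.sum_sub_distrib, ← Finset.sum_mul,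
      ← Complex.ofReal_sum, ← map_sum, sum_coord_mul_fderiv, ← norm_sq_eq_sum]
    rw [divRadial]
    simp
    ring
  have hi : ∀ j, Integrable fun x => fderiv ℝ
      (fun y => (weight ε y : ℂ) * ((y j * u y) * conj (u y))) x (stdVec j) := by
    intro j
    have hb1 : ∀ x : E d, ‖(weight ε x : ℂ) * x j‖ ≤ (√ε)⁻¹ :=
      fun x => norm_weight_mul_coord_le hε x j
    have h1 := integrable_bdd_mul_mul_conj hw (norm_ofReal_weight_le hε.le) hu.memLp hu.memLp
    have h2 := integrable_bdd_mul_mul_conj (m := fun x : E d => (weight ε x : ℂ) * x j)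
      (by fun_prop) hb1 (hu.memLp_fderiv j) hu.memLp
    have h3 := integrable_bdd_mul_mul_conj (m := fun x : E d => (weight ε x : ℂ) * x j)
      (by fun_prop) hb1 hu.memLp (hu.memLp_fderiv j)
    have h4 := integrable_bdd_mul_mul_conj
      (m := fun x : E d => 2 * ε * ((weight ε x * x j) * (weight ε x * x j)))
      (C := 2 * ε * ((√ε)⁻¹ * (√ε)⁻¹)) (by fun_prop) (fun x => by
        have h3 : (2 * ε * ((weight ε x * x j) * (weight ε x * x j)) : ℂ)
          = ((2 * ε : ℝ) : ℂ) * ((weight ε x * x j) * (weight ε x * x j)) := by push_cast; ring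
        rw [h3, norm_mul, Complex.norm_real, Real.norm_of_nonneg (by positivity), norm_mul]
        have := hb1 x
        gcongr)
      hu.memLp hu.memLp
    refine (((h1.add h2).add h3).sub h4).congr (ae_of_all _ fun x => ?_)
    simp only
    rw [(fderiv_weight_mul_mul_conj hε.le (hd1 j x) (hu.differentiable x) j).2, hd2]
    simp only [Pi.add_apply, Pi.sub_apply]
    ring
  rw [e]
  refine ⟨integrable_finsetSum _ fun j _ => hi j, ?_⟩
  rw [integral_finsetSum _ fun j _ => hi j]
  refine Finset.sum_eq_zero fun j _ => integral_fderiv_eq_zero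
    (fun x => (fderiv_weight_mul_mul_conj hε.le (hd1 j x) (hu.differentiable x) j).1) ?_ (hi j)
  refine (integrable_bdd_mul_mul_conj (m := fun x : E d => (weight ε x : ℂ) * x j)
      (by fun_prop) (fun x => norm_weight_mul_coord_le hε x j) hu.memLp hu.memLp).congr
      (ae_of_all _ fun x => ?_)
  simp only
  ring

end Derivatives

/-! ### Energy estimates -/

section Energy

variable {d : ℕ} {u : E d → ℂ} {ε : ℝ} {z : ℂ}

theorem formalOp_zero_apply (u : E d → ℂ) (x : E d) :
    formalOp 0 u x = Laplacian.laplacian u x - 2 * fderiv ℝ u x x := by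
  simp [formalOp]

theorem two_mul_weight_mul_norm_fderiv_le (hε : 0 ≤ ε) (u : E d → ℂ) (x : E d) :
    2 * √ε * weight ε x * ‖fderiv ℝ u x x * conj (u x)‖ ≤ (gradSq u x + ‖u x‖ ^ 2) / 2 := by
  have h1 := norm_fderiv_apply_le u x x
  have h2 := two_mul_sqrt_mul_norm_mul_weight_le hε x
  have hw := (weight_pos hε x).le
  rw [norm_mul, RCLike.norm_conj]
  calc 2 * √ε * weight ε x * (‖fderiv ℝ u x x‖ * ‖u x‖)
      ≤ 2 * √ε * weight ε x * (‖x‖ * √(gradSq u x) * ‖u x‖) := by gcongr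
    _ = 2 * √ε * ‖x‖ * weight ε x * (√(gradSq u x) * ‖u x‖) := by ring
    _ ≤ 1 * (√(gradSq u x) * ‖u x‖) := by gcongr
    _ ≤ _ := by nlinarith [sq_nonneg (√(gradSq u x) - ‖u x‖), Real.sq_sqrt (gradSq_nonneg u x)]

/-- Up to divergences, `2 Re (x · ∇u ū) = x · ∇|u|²` becomes `-d |u|²`; this is the origin of the
shift by `d`. Differentiating the weight leaves two error terms with a factor `ε`. -/
theorem re_energy_eq (u : E d → ℂ) (x : E d) (z : ℂ) (ε : ℝ) :
    (z.re - d) * (weight ε x * ‖u x‖ ^ 2) + weight ε x * gradSq u x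
      = weight ε x * ((z * u x - formalOp 0 u x) * conj (u x)).re
        + (divGrad ε u x).re - (divRadial ε u x).re
        - 2 * ε * ‖x‖ ^ 2 * weight ε x ^ 2 * ‖u x‖ ^ 2
        + 2 * ε * weight ε x ^ 2 * (fderiv ℝ u x x * conj (u x)).re := by
  rw [formalOp_zero_apply, divGrad, divRadial, Complex.sq_norm, Complex.normSq_apply]
  simp [← Complex.ofReal_pow]
  ring

/-- The imaginary part removes `|∇u|²` and isolates `Im z`. The drift term does not cancel, but with
the weight it is bounded by `|∇u|²` and `|u|²`, which the real part controls. -/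
theorem im_energy_eq (u : E d → ℂ) (x : E d) (z : ℂ) (ε : ℝ) :
    z.im * (weight ε x * ‖u x‖ ^ 2)
      = weight ε x * ((z * u x - formalOp 0 u x) * conj (u x)).im
        + (divGrad ε u x).im - 2 * weight ε x * (fderiv ℝ u x x * conj (u x)).im
        + 2 * ε * weight ε x ^ 2 * (fderiv ℝ u x x * conj (u x)).im := by
  rw [formalOp_zero_apply, divGrad, Complex.sq_norm, Complex.normSq_apply]
  simp [← Complex.ofReal_pow]
  ring

theorem re_energy_le (hε : 0 ≤ ε) (u : E d → ℂ) (x : E d) (z : ℂ) {b : ℝ} (hb : 0 < b)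
    (hz : z.re = d + b) :
    weight ε x * (b * ‖u x‖ ^ 2 + gradSq u x)
      ≤ ‖z * u x - formalOp 0 u x‖ ^ 2 / (2 * b) + b / 2 * ‖u x‖ ^ 2
        + √ε * ((gradSq u x + ‖u x‖ ^ 2) / 2) + ((divGrad ε u x).re - (divRadial ε u x).re) := by
  have h0 := re_energy_eq u x z ε
  have hw := weight_pos hε x
  have hw1 := weight_le_one hε x
  have h1 : weight ε x * ((z * u x - formalOp 0 u x) * conj (u x)).re
      ≤ ‖z * u x - formalOp 0 u x‖ ^ 2 / (2 * b) + b / 2 * ‖u x‖ ^ 2 := by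
    calc _ ≤ weight ε x * (‖z * u x - formalOp 0 u x‖ * ‖u x‖) := by
          gcongr
          refine (Complex.re_le_norm _).trans (le_of_eq ?_)
          rw [norm_mul, RCLike.norm_conj]
      _ ≤ 1 * (‖z * u x - formalOp 0 u x‖ * ‖u x‖) := by gcongr
      _ ≤ _ := by
          have : ‖z * u x - formalOp 0 u x‖ ^ 2 / (2 * b) + b / 2 * ‖u x‖ ^ 2
              - ‖z * u x - formalOp 0 u x‖ * ‖u x‖
              = (‖z * u x - formalOp 0 u x‖ - b * ‖u x‖) ^ 2 / (2 * b) := by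
            field_simp
            ring
          have h2 : 0 ≤ (‖z * u x - formalOp 0 u x‖ - b * ‖u x‖) ^ 2 / (2 * b) := by positivity
          linarith
  have h2 : 2 * ε * weight ε x ^ 2 * (fderiv ℝ u x x * conj (u x)).re
      ≤ √ε * ((gradSq u x + ‖u x‖ ^ 2) / 2) := by
    calc _ ≤ 2 * ε * weight ε x ^ 2 * ‖fderiv ℝ u x x * conj (u x)‖ := by
          gcongr
          exact Complex.re_le_norm _
      -- Splitting `ε = √ε √ε` spends one root on the factor `|x|` and keeps the other to make the
      -- error vanish as `ε → 0`.
      _ = √ε * (weight ε x * (2 * √ε * weight ε x * ‖fderiv ℝ u x x * conj (u x)‖)) := by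
          nth_rewrite 1 [← Real.mul_self_sqrt hε]
          ring
      _ ≤ √ε * (1 * ((gradSq u x + ‖u x‖ ^ 2) / 2)) := by
          gcongr
          exact two_mul_weight_mul_norm_fderiv_le hε u x
      _ = _ := by rw [one_mul]
  -- This error term enters the identity with a negative sign and can be dropped.
  have h3 : 0 ≤ 2 * ε * ‖x‖ ^ 2 * weight ε x ^ 2 * ‖u x‖ ^ 2 := by positivity
  have h4 : z.re - d = b := by rw [hz]; ring
  rw [h4] at h0
  linarith

/-- No limit in `ε` is taken: `weight 1` is exactly the decay `⟨x⟩⁻²` of the potential. -/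
theorem im_energy_le (u : E d → ℂ) (x : E d) (z : ℂ) :
    z.im * (weight 1 x * ‖u x‖ ^ 2)
      ≤ ‖z * u x - formalOp 0 u x‖ ^ 2 / 2 + 3 / 2 * ‖u x‖ ^ 2 + gradSq u x
        + (divGrad 1 u x).im := by
  have h0 := im_energy_eq u x z 1
  have hw := weight_pos zero_le_one x
  have hw1 := weight_le_one zero_le_one x
  have h1 : weight 1 x * ((z * u x - formalOp 0 u x) * conj (u x)).im
      ≤ ‖z * u x - formalOp 0 u x‖ ^ 2 / 2 + ‖u x‖ ^ 2 / 2 := by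
    calc _ ≤ weight 1 x * (‖z * u x - formalOp 0 u x‖ * ‖u x‖) := by
          gcongr
          refine (Complex.im_le_norm _).trans (le_of_eq ?_)
          rw [norm_mul, RCLike.norm_conj]
      _ ≤ 1 * (‖z * u x - formalOp 0 u x‖ * ‖u x‖) := by gcongr
      _ ≤ _ := by nlinarith [sq_nonneg (‖z * u x - formalOp 0 u x‖ - ‖u x‖)]
  have h2 := two_mul_weight_mul_norm_fderiv_le zero_le_one u x
  rw [Real.sqrt_one, mul_one] at h2
  set P := fderiv ℝ u x x * conj (u x)
  have hP := Complex.abs_im_le_norm P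
  rw [abs_le] at hP
  have h3 : -2 * weight 1 x * P.im ≤ (gradSq u x + ‖u x‖ ^ 2) / 2 := by nlinarith
  have h4 : 2 * weight 1 x ^ 2 * P.im ≤ (gradSq u x + ‖u x‖ ^ 2) / 2 := by
    have : weight 1 x * (2 * weight 1 x * P.im) ≤ weight 1 x * ((gradSq u x + ‖u x‖ ^ 2) / 2) := by
      gcongr
      nlinarith
    have h5 : 0 ≤ (gradSq u x + ‖u x‖ ^ 2) / 2 := by
      have := gradSq_nonneg u x
      positivity
    nlinarith
  linarith

theorem IsSobolev.integrable_norm_sq (hu : IsSobolev u) : Integrable fun x => ‖u x‖ ^ 2 :=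
  hu.memLp.integrable_norm_pow (by norm_num)

theorem IsSobolev.integrable_gradSq (hu : IsSobolev u) : Integrable (gradSq u) :=
  integrable_finsetSum _ fun j _ => (hu.memLp_fderiv j).integrable_norm_pow (by norm_num)

theorem tendsto_integral_weight_mul {h : E d → ℝ} (hh : Integrable h) :
    Tendsto (fun ε : ℝ => ∫ x, weight ε x * h x) (𝓝[>] 0) (𝓝 (∫ x, h x)) := by
  refine tendsto_integral_filter_of_dominated_convergence (fun x => ‖h x‖) ?_ ?_ hh.norm ?_
  · filter_upwards [self_mem_nhdsWithin] with ε hε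
    exact (continuous_weight (le_of_lt hε)).aestronglyMeasurable.mul hh.1
  · filter_upwards [self_mem_nhdsWithin] with ε hε
    refine ae_of_all _ fun x => ?_
    rw [norm_mul, Real.norm_of_nonneg (weight_pos (le_of_lt hε) x).le]
    exact mul_le_of_le_one_left (norm_nonneg _) (weight_le_one (le_of_lt hε) x)
  · refine ae_of_all _ fun x => ?_
    have hc : ContinuousAt (fun ε : ℝ => weight ε x * h x) 0 := by
      unfold weight
      refine (ContinuousAt.inv₀ (by fun_prop) ?_).mul continuousAt_const
      simp
    have := hc.tendsto.mono_left (nhdsWithin_le_nhds (s := Ioi 0))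
    simpa [weight] using this

/-- After integration of `re_energy_le` the divergences disappear. Dominated convergence removes the
weight on the left, and the error is a constant times `√ε`. -/
theorem IsSobolev.energy_le (hu : IsSobolev u) {b : ℝ} (hb : 0 < b) (hz : z.re = d + b)
    (hF : MemLp (fun x => z * u x - formalOp 0 u x) 2 volume) :
    b * (∫ x, ‖u x‖ ^ 2) + ∫ x, gradSq u x
      ≤ (∫ x, ‖z * u x - formalOp 0 u x‖ ^ 2) / (2 * b) + b / 2 * ∫ x, ‖u x‖ ^ 2 := by
  have iu := hu.integrable_norm_sq
  have ig := hu.integrable_gradSq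
  have iF : Integrable fun x => ‖z * u x - formalOp 0 u x‖ ^ 2 :=
    hF.integrable_norm_pow (by norm_num)
  have ih : Integrable fun x => b * ‖u x‖ ^ 2 + gradSq u x := (iu.const_mul b).add ig
  have l1 := tendsto_integral_weight_mul ih
  have key : ∀ ε : ℝ, 0 < ε → ∫ x, weight ε x * (b * ‖u x‖ ^ 2 + gradSq u x)
      ≤ (∫ x, ‖z * u x - formalOp 0 u x‖ ^ 2) / (2 * b) + b / 2 * (∫ x, ‖u x‖ ^ 2)
        + √ε * (((∫ x, gradSq u x) + ∫ x, ‖u x‖ ^ 2) / 2) := by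
    intro ε hε
    obtain ⟨i1, e1⟩ := hu.integral_divGrad hε
    obtain ⟨i2, e2⟩ := hu.integral_divRadial hε
    have e1' : ∫ x, (divGrad ε u x).re = 0 := by
      have := integral_re i1
      simpa [e1] using this
    have e2' : ∫ x, (divRadial ε u x).re = 0 := by
      have := integral_re i2
      simpa [e2] using this
    have i1' : Integrable fun x => (divGrad ε u x).re := i1.re
    have i2' : Integrable fun x => (divRadial ε u x).re := i2.re
    have j1 : Integrable fun x => ‖z * u x - formalOp 0 u x‖ ^ 2 / (2 * b) + b / 2 * ‖u x‖ ^ 2 :=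
      (iF.div_const _).add (iu.const_mul _)
    have j2 : Integrable fun x => √ε * ((gradSq u x + ‖u x‖ ^ 2) / 2) :=
      ((ig.add iu).div_const _).const_mul _
    have j3 : Integrable fun x => (divGrad ε u x).re - (divRadial ε u x).re := i1'.sub i2'
    have j4 : Integrable fun x => ‖z * u x - formalOp 0 u x‖ ^ 2 / (2 * b) + b / 2 * ‖u x‖ ^ 2
        + √ε * ((gradSq u x + ‖u x‖ ^ 2) / 2) := j1.add j2
    have hle := integral_mono_of_nonneg (μ := (volume : Measure (E d)))
      (f := fun x => weight ε x * (b * ‖u x‖ ^ 2 + gradSq u x))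
      (ae_of_all _ fun x => by
        have h1 := weight_pos hε.le x
        have h2 := gradSq_nonneg u x
        simp only [Pi.zero_apply]
        positivity)
      (j4.add j3) (ae_of_all _ fun x => re_energy_le hε.le u x z hb hz)
    refine hle.trans (le_of_eq ?_)
    simp only [Pi.add_apply]
    rw [integral_add j4 j3, integral_add j1 j2, integral_add (iF.div_const _) (iu.const_mul _),
      integral_sub i1' i2', e1', e2', integral_const_mul, integral_div, integral_const_mul,
      integral_div, integral_add ig iu]
    ring
  have l2 : Tendsto (fun ε : ℝ => (∫ x, ‖z * u x - formalOp 0 u x‖ ^ 2) / (2 * b)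
      + b / 2 * (∫ x, ‖u x‖ ^ 2) + √ε * (((∫ x, gradSq u x) + ∫ x, ‖u x‖ ^ 2) / 2)) (𝓝[>] 0)
      (𝓝 ((∫ x, ‖z * u x - formalOp 0 u x‖ ^ 2) / (2 * b)
      + b / 2 * (∫ x, ‖u x‖ ^ 2) + √0 * (((∫ x, gradSq u x) + ∫ x, ‖u x‖ ^ 2) / 2))) :=
    (((Real.continuous_sqrt.tendsto 0).mono_left nhdsWithin_le_nhds).mul_const _).const_add _
  have := le_of_tendsto_of_tendsto l1 l2 (by
    filter_upwards [self_mem_nhdsWithin] with ε hε using key ε hε)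
  rw [integral_add (iu.const_mul b) ig, integral_const_mul] at this
  simpa using this

theorem IsSobolev.sq_mul_integral_le (hu : IsSobolev u) {b : ℝ} (hb : 0 < b) (hz : z.re = d + b)
    (hF : MemLp (fun x => z * u x - formalOp 0 u x) 2 volume) :
    b ^ 2 * ∫ x, ‖u x‖ ^ 2 ≤ ∫ x, ‖z * u x - formalOp 0 u x‖ ^ 2 := by
  have h := hu.energy_le hb hz hF
  have h1 : 0 ≤ ∫ x, gradSq u x := integral_nonneg fun x => gradSq_nonneg u x
  have h2 : b / 2 * (∫ x, ‖u x‖ ^ 2) ≤ (∫ x, ‖z * u x - formalOp 0 u x‖ ^ 2) / (2 * b) := by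
    linarith
  rw [le_div_iff₀ (by positivity)] at h2
  linarith

/-- At high frequencies, the solutions of the resolvent equation are small near the origin. -/
theorem IsSobolev.im_mul_integral_weight_le (hu : IsSobolev u) {b : ℝ} (hb : 0 < b)
    (hz : z.re = d + b) (hz' : 0 ≤ z.im)
    (hF : MemLp (fun x => z * u x - formalOp 0 u x) 2 volume) :
    z.im * ∫ x, weight 1 x * ‖u x‖ ^ 2
      ≤ (1 / 2 + 3 / (2 * b ^ 2) + 1 / (2 * b)) * ∫ x, ‖z * u x - formalOp 0 u x‖ ^ 2 := by
  have iu := hu.integrable_norm_sq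
  have ig := hu.integrable_gradSq
  have iF : Integrable fun x => ‖z * u x - formalOp 0 u x‖ ^ 2 :=
    hF.integrable_norm_pow (by norm_num)
  obtain ⟨i1, e1⟩ := hu.integral_divGrad one_pos
  have e1' : ∫ x, (divGrad 1 u x).im = 0 := by
    have := integral_im i1
    simpa [e1] using this
  have i1' : Integrable fun x => (divGrad 1 u x).im := i1.im
  have j1 : Integrable fun x => ‖z * u x - formalOp 0 u x‖ ^ 2 / 2 + 3 / 2 * ‖u x‖ ^ 2 :=
    (iF.div_const _).add (iu.const_mul _)
  have j2 : Integrable fun x => ‖z * u x - formalOp 0 u x‖ ^ 2 / 2 + 3 / 2 * ‖u x‖ ^ 2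
      + gradSq u x := j1.add ig
  have hle := integral_mono_of_nonneg (μ := (volume : Measure (E d)))
    (f := fun x => z.im * (weight 1 x * ‖u x‖ ^ 2))
    (ae_of_all _ fun x => by
      have h1 := weight_pos zero_le_one x
      simp only [Pi.zero_apply]
      positivity)
    (j2.add i1') (ae_of_all _ fun x => im_energy_le u x z)
  simp only [Pi.add_apply] at hle
  rw [integral_add j2 i1', integral_add j1 ig, integral_add (iF.div_const _) (iu.const_mul _),
    e1', integral_const_mul, integral_const_mul, integral_div] at hle
  have h1 := hu.energy_le hb hz hF
  have h2 := hu.sq_mul_integral_le hb hz hF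
  set N := ∫ x, ‖z * u x - formalOp 0 u x‖ ^ 2
  set U := ∫ x, ‖u x‖ ^ 2
  have hU : 0 ≤ U := integral_nonneg fun x => by positivity
  have h3 : U ≤ N / b ^ 2 := by
    rw [le_div_iff₀ (by positivity)]
    linarith
  have h4 : b / 2 * U ≥ 0 := by positivity
  -- The three constants come from `N / 2`, from `U ≤ N / b²`, and from `∫ |∇u|² ≤ N / (2b)`, which
  -- is `energy_le` with `b/2 * U` discarded.
  have h5 : (1 / 2 + 3 / (2 * b ^ 2) + 1 / (2 * b)) * N
      = N / 2 + 3 / 2 * (N / b ^ 2) + N / (2 * b) := by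
    field_simp
  rw [h5]
  linarith

end Energy

/-! ### Gaussian wave packets -/

section Gauss

variable {d : ℕ}

/-- The Gaussian wave packet `exp (-a |x|² + i k · x + c)`. -/
def gauss (a : ℝ) (k : E d) (c : ℝ) (x : E d) : ℂ :=
  Complex.exp (((-a * ‖x‖ ^ 2 : ℝ) : ℂ) + Complex.I * ((inner ℝ k x : ℝ) : ℂ) + c)

/-- The derivative of the exponent of `gauss a k c`. -/
def gaussPhase (a : ℝ) (k x : E d) : E d →L[ℝ] ℂ :=
  Complex.ofRealCLM.comp ((-(2 * a)) • innerSL ℝ x)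
    + Complex.I • Complex.ofRealCLM.comp (innerSL ℝ k)

theorem gaussPhase_apply (a : ℝ) (k x v : E d) :
    gaussPhase a k x v = -(2 * a) * (inner ℝ x v : ℝ) + Complex.I * (inner ℝ k v : ℝ) := by
  simp [gaussPhase]

theorem norm_gauss (a : ℝ) (k : E d) (c : ℝ) (x : E d) :
    ‖gauss a k c x‖ = Real.exp (-a * ‖x‖ ^ 2 + c) := by
  rw [gauss, Complex.norm_exp]
  rw [Complex.add_re, Complex.add_re, Complex.ofReal_re, Complex.ofReal_re, Complex.I_mul_re,
    Complex.ofReal_im, neg_zero, add_zero]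

theorem hasFDerivAt_gauss (a : ℝ) (k : E d) (c : ℝ) (x : E d) :
    HasFDerivAt (gauss a k c) (gauss a k c x • gaussPhase a k x) x := by
  have h1 : HasFDerivAt (fun y : E d => ((-a * ‖y‖ ^ 2 : ℝ) : ℂ))
      (Complex.ofRealCLM.comp ((-a) • (2 • innerSL ℝ x))) x :=
    Complex.ofRealCLM.hasFDerivAt.comp x ((hasStrictFDerivAt_norm_sq x).hasFDerivAt.const_mul _)
  have h2 : HasFDerivAt (fun y : E d => ((inner ℝ k y : ℝ) : ℂ))
      (Complex.ofRealCLM.comp (innerSL ℝ k)) x :=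
    (Complex.ofRealCLM.comp (innerSL ℝ k)).hasFDerivAt
  have h3 := ((h1.add (h2.const_mul Complex.I)).add_const (c : ℂ)).cexp
  refine h3.congr_fderiv ?_
  ext v
  simp [gauss, gaussPhase_apply]
  ring

theorem contDiff_gauss (a : ℝ) (k : E d) (c : ℝ) {n : WithTop ℕ∞} : ContDiff ℝ n (gauss a k c) := by
  have h1 : ContDiff ℝ n (fun y : E d => ((-a * ‖y‖ ^ 2 : ℝ) : ℂ)) :=
    Complex.ofRealCLM.contDiff.comp (contDiff_const.mul (contDiff_norm_sq ℝ))
  have h2 : ContDiff ℝ n (fun y : E d => ((inner ℝ k y : ℝ) : ℂ)) :=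
    Complex.ofRealCLM.contDiff.comp (innerSL ℝ k).contDiff
  exact ((h1.add (contDiff_const.mul h2)).add contDiff_const).cexp

theorem fderiv_gauss (a : ℝ) (k : E d) (c : ℝ) :
    fderiv ℝ (gauss a k c) = fun x => gauss a k c x • gaussPhase a k x :=
  funext fun x => (hasFDerivAt_gauss a k c x).fderiv

/-- The quotient of `formalOp 0 (gauss a k c)` by `gauss a k c`. -/
def gaussSymbol (a : ℝ) (k x : E d) : ℂ :=
  (4 * a ^ 2 + 4 * a) * ‖x‖ ^ 2 - (4 * a + 2) * (Complex.I * (inner ℝ k x : ℝ)) - ‖k‖ ^ 2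
    - 2 * a * d

/-- The free operator multiplies a packet by a polynomial of degree two in `x`, of the same form as
the exponent. The packets are therefore preserved by the evolution, with ordinary differential
equations for their parameters. -/
theorem formalOp_gauss (a : ℝ) (k : E d) (c : ℝ) (x : E d) :
    formalOp 0 (gauss a k c) x = gauss a k c x * gaussSymbol a k x := by
  have hlin : ∀ j, HasFDerivAt (fun y : E d => gaussPhase a k y (stdVec j))
      (Complex.ofRealCLM.comp ((-(2 * a)) • (EuclideanSpace.proj j : E d →L[ℝ] ℝ))) x := by
    intro j
    have h0 : (fun y : E d => gaussPhase a k y (stdVec j)) = fun y =>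
        (Complex.ofRealCLM.comp ((-(2 * a)) • (EuclideanSpace.proj j : E d →L[ℝ] ℝ))) y
          + Complex.I * (inner ℝ k (stdVec j) : ℝ) := by
      funext y
      simp [gaussPhase_apply, EuclideanSpace.inner_single_right]
    rw [h0]
    exact (ContinuousLinearMap.hasFDerivAt _).add_const _
  have h2 : ∀ j, fderiv ℝ (fun y => fderiv ℝ (gauss a k c) y (stdVec j)) x (stdVec j)
      = gauss a k c x * (4 * a ^ 2 * ((x j : ℝ) ^ 2 : ℝ)
        - 4 * a * Complex.I * ((x j * k j : ℝ) : ℂ) - ((k j) ^ 2 : ℝ) - 2 * a) := by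
    intro j
    have h3 : (fun y => fderiv ℝ (gauss a k c) y (stdVec j))
        = fun y => gauss a k c y * gaussPhase a k y (stdVec j) := by
      funext y
      rw [fderiv_gauss]
      rfl
    rw [h3]
    have h4 := ((hasFDerivAt_gauss a k c x).mul (hlin j)).fderiv
    simp only [Pi.mul_def] at h4
    rw [h4]
    simp only [add_apply, smul_apply, ContinuousLinearMap.comp_apply, smul_eq_mul,
      gaussPhase_apply, Complex.ofRealCLM_apply, EuclideanSpace.inner_single_right]
    simp
    ring_nf
    rw [Complex.I_sq]
    ring
  have hin : (inner ℝ k x : ℝ) = ∑ j, x j * k j := by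
    simp [PiLp.inner_apply]
  rw [formalOp_zero_apply, laplacian_eq_sum (contDiff_gauss a k c),
    Finset.sum_congr rfl fun j _ => h2 j, ← Finset.mul_sum, fderiv_gauss]
  simp only [Finset.sum_sub_distrib, ← Finset.mul_sum, ← Complex.ofReal_sum, ← norm_sq_eq_sum,
    ← hin]
  simp only [smul_apply, gaussPhase_apply, smul_eq_mul, gaussSymbol, Finset.sum_const,
    Finset.card_univ, Fintype.card_fin, nsmul_eq_mul, real_inner_self_eq_norm_sq]
  push_cast
  ring

/-! ### Gaussian decay and square integrability. -/

theorem one_add_sq_mul_exp_le {a : ℝ} (ha : 0 < a) (r : ℝ) :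
    (1 + r) ^ 2 * Real.exp (-a * r ^ 2) ≤ (2 + 4 / a) * Real.exp (-(a / 2) * r ^ 2) := by
  have h1 : Real.exp (-a * r ^ 2) = Real.exp (-(a / 2) * r ^ 2) * (Real.exp (a / 2 * r ^ 2))⁻¹ := by
    rw [← Real.exp_neg, ← Real.exp_add]
    congr 1
    ring
  have h2 := Real.add_one_le_exp (a / 2 * r ^ 2)
  -- Half of the exponent pays for the polynomial: `exp (a r² / 2) ≥ 1 + a r² / 2`, and the factor
  -- `2 + 4 / a` turns this into at least `2 + 2 r² ≥ (1 + r)²`.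
  have h3 : (1 + r) ^ 2 ≤ (2 + 4 / a) * Real.exp (a / 2 * r ^ 2) := by
    have h4 : (2 + 4 / a) * (a / 2 * r ^ 2 + 1) ≤ (2 + 4 / a) * Real.exp (a / 2 * r ^ 2) := by
      gcongr
    have h5 : (2 + 4 / a) * (a / 2 * r ^ 2 + 1) = a * r ^ 2 + 2 + 2 * r ^ 2 + 4 / a := by
      field_simp
      ring
    have h6 : 0 < 4 / a := by positivity
    nlinarith [sq_nonneg (1 - r), mul_nonneg ha.le (sq_nonneg r)]
  rw [h1]
  have h7 := Real.exp_pos (a / 2 * r ^ 2)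
  calc (1 + r) ^ 2 * (Real.exp (-(a / 2) * r ^ 2) * (Real.exp (a / 2 * r ^ 2))⁻¹)
      ≤ (2 + 4 / a) * Real.exp (a / 2 * r ^ 2)
        * (Real.exp (-(a / 2) * r ^ 2) * (Real.exp (a / 2 * r ^ 2))⁻¹) := by gcongr
    _ = _ := by field_simp

theorem memLp_exp_neg_mul_sq {a : ℝ} (ha : 0 < a) :
    MemLp (fun x : E d => Real.exp (-a * ‖x‖ ^ 2)) 2 volume := by
  have hc : Continuous fun x : E d => Real.exp (-a * ‖x‖ ^ 2) := by fun_prop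
  refine (memLp_two_iff_integrable_sq_norm hc.aestronglyMeasurable).2 ?_
  have h := (GaussianFourier.integrable_cexp_neg_mul_sq_norm_add (V := E d) (b := ((2 * a : ℝ) : ℂ))
    (by simpa using ha) 0 0).norm
  refine h.congr (ae_of_all _ fun x => ?_)
  simp only
  rw [Complex.norm_exp, Real.norm_of_nonneg (Real.exp_pos _).le, ← Real.exp_nat_mul]
  congr 1
  simp [← Complex.ofReal_pow]
  ring

theorem memLp_of_norm_le_exp {F : Type*} [NormedAddCommGroup F] {f : E d → F} {a M : ℝ}
    (ha : 0 < a) (hM : 0 ≤ M) (hf : AEStronglyMeasurable f (volume : Measure (E d)))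
    (h : ∀ x, ‖f x‖ ≤ M * (1 + ‖x‖) ^ 2 * Real.exp (-a * ‖x‖ ^ 2)) :
    MemLp f 2 (volume : Measure (E d)) := by
  refine ((memLp_exp_neg_mul_sq (d := d) (a := a / 2) (by positivity)).const_mul
    (M * (2 + 4 / a))).mono hf (ae_of_all _ fun x => (h x).trans ?_)
  have h1 := mul_le_mul_of_nonneg_left (one_add_sq_mul_exp_le ha ‖x‖) hM
  rw [Real.norm_of_nonneg (by positivity)]
  calc _ = _ := by ring
    _ ≤ _ := h1
    _ = _ := by ring

theorem norm_gaussPhase_le (a : ℝ) (k x : E d) :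
    ‖gaussPhase a k x‖ ≤ (2 * |a| + ‖k‖) * (1 + ‖x‖) := by
  refine ContinuousLinearMap.opNorm_le_bound _ (by positivity) fun v => ?_
  rw [gaussPhase_apply]
  refine (norm_add_le _ _).trans ?_
  have h1 := abs_real_inner_le_norm x v
  have h2 := abs_real_inner_le_norm k v
  have e1 : ‖(-(2 * (a : ℂ))) * ((inner ℝ x v : ℝ) : ℂ)‖ = 2 * |a| * |inner ℝ x v| := by
    simp
  have e2 : ‖Complex.I * ((inner ℝ k v : ℝ) : ℂ)‖ = |inner ℝ k v| := by
    simp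
  rw [e1, e2]
  calc 2 * |a| * |inner ℝ x v| + |inner ℝ k v| ≤ 2 * |a| * (‖x‖ * ‖v‖) + ‖k‖ * ‖v‖ := by gcongr
    _ ≤ _ := by
      have := abs_nonneg a
      have h3 : 0 ≤ 2 * |a| * ‖v‖ := by positivity
      have h4 : 0 ≤ ‖k‖ * ‖x‖ * ‖v‖ := by positivity
      nlinarith

theorem norm_gaussSymbol_le {a : ℝ} (ha : 0 ≤ a) (ha1 : a ≤ 1) (k x : E d) :
    ‖gaussSymbol a k x‖ ≤ (8 + 6 * ‖k‖ + ‖k‖ ^ 2 + 2 * d) * (1 + ‖x‖) ^ 2 := by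
  have e1 : ‖((4 * a ^ 2 + 4 * a) * ‖x‖ ^ 2 : ℂ)‖ ≤ 8 * ‖x‖ ^ 2 := by
    have : ((4 * a ^ 2 + 4 * a) * ‖x‖ ^ 2 : ℂ) = (((4 * a ^ 2 + 4 * a) * ‖x‖ ^ 2 : ℝ) : ℂ) := by
      push_cast; ring
    rw [this, Complex.norm_real, Real.norm_of_nonneg (by positivity)]
    gcongr
    nlinarith
  have e2 : ‖((4 * a + 2) * (Complex.I * (inner ℝ k x : ℝ)) : ℂ)‖ ≤ 6 * (‖k‖ * ‖x‖) := by
    have : ((4 * a + 2 : ℂ)) = ((4 * a + 2 : ℝ) : ℂ) := by push_cast; ring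
    rw [this, norm_mul, norm_mul, Complex.norm_I, one_mul, Complex.norm_real, Complex.norm_real,
      Real.norm_of_nonneg (by positivity)]
    have := abs_real_inner_le_norm k x
    rw [Real.norm_eq_abs]
    gcongr
    linarith
  have e3 : ‖((‖k‖ : ℂ)) ^ 2‖ = ‖k‖ ^ 2 := by simp
  have e4 : ‖(2 * a * d : ℂ)‖ ≤ 2 * d := by
    simp only [norm_mul, Complex.norm_ofNat, Complex.norm_real, Complex.norm_natCast,
      Real.norm_of_nonneg ha]
    have : (0 : ℝ) ≤ d := by positivity
    nlinarith
  have h := (norm_sub_le ((4 * (a : ℂ) ^ 2 + 4 * a) * (‖x‖ : ℂ) ^ 2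
    - (4 * (a : ℂ) + 2) * (Complex.I * (inner ℝ k x : ℝ)) - (‖k‖ : ℂ) ^ 2) (2 * (a : ℂ) * d)).trans
    (add_le_add ((norm_sub_le _ _).trans (add_le_add ((norm_sub_le _ _).trans
      (add_le_add e1 e2)) e3.le)) e4)
  refine h.trans ?_
  have hk := norm_nonneg k
  have hx := norm_nonneg x
  have hkx := mul_nonneg hk hx
  have hd : (0 : ℝ) ≤ d := by positivity
  have : 0 ≤ (‖k‖ ^ 2 + 2 * d) * (2 * ‖x‖ + ‖x‖ ^ 2) := by positivity
  have h2 : 0 ≤ ‖k‖ * (1 + ‖x‖ + ‖x‖ ^ 2) := by positivity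
  nlinarith

/-- Replacing `a` by a lower bound `m` in the exponent makes the estimate uniform over a range of
widths, as needed to differentiate under the integral. -/
theorem norm_gauss_mul_gaussSymbol_le {a m : ℝ} (ha : 0 ≤ a) (hm : m ≤ a) (ha1 : a ≤ 1)
    (k : E d) (c : ℝ) (x : E d) :
    ‖gauss a k c x * gaussSymbol a k x‖ ≤ Real.exp c * (8 + 6 * ‖k‖ + ‖k‖ ^ 2 + 2 * d)
      * (1 + ‖x‖) ^ 2 * Real.exp (-m * ‖x‖ ^ 2) := by
  rw [norm_mul, norm_gauss]
  have h1 := norm_gaussSymbol_le ha ha1 k x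
  have h2 : Real.exp (-a * ‖x‖ ^ 2 + c) ≤ Real.exp (-m * ‖x‖ ^ 2) * Real.exp c := by
    rw [← Real.exp_add]
    gcongr
  calc _ ≤ (Real.exp (-m * ‖x‖ ^ 2) * Real.exp c)
        * ((8 + 6 * ‖k‖ + ‖k‖ ^ 2 + 2 * d) * (1 + ‖x‖) ^ 2) := by gcongr
    _ = _ := by ring

theorem memLp_gauss {a : ℝ} (ha : 0 < a) (k : E d) (c : ℝ) : MemLp (gauss a k c) 2 volume := by
  refine memLp_of_norm_le_exp (M := Real.exp c) ha (Real.exp_pos c).le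
    (contDiff_gauss a k c (n := 0)).continuous.aestronglyMeasurable fun x => ?_
  rw [norm_gauss, Real.exp_add, mul_comm (Real.exp c), mul_assoc, mul_comm (Real.exp (-a * _))]
  exact le_mul_of_one_le_left (by positivity) (one_le_pow₀ (by linarith [norm_nonneg x]))

theorem continuous_gaussSymbol (a : ℝ) (k : E d) : Continuous (gaussSymbol a k) := by
  unfold gaussSymbol
  fun_prop

theorem memLp_formalOp_gauss {a : ℝ} (ha : 0 < a) (ha1 : a ≤ 1) (k : E d) (c : ℝ) :
    MemLp (formalOp 0 (gauss a k c)) 2 volume := by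
  have e : formalOp 0 (gauss a k c) = fun x => gauss a k c x * gaussSymbol a k x :=
    funext fun x => formalOp_gauss a k c x
  rw [e]
  exact memLp_of_norm_le_exp (M := Real.exp c * (8 + 6 * ‖k‖ + ‖k‖ ^ 2 + 2 * d)) ha
    (by positivity) ((contDiff_gauss a k c (n := 0)).continuous.mul
      (continuous_gaussSymbol a k)).aestronglyMeasurable
    fun x => norm_gauss_mul_gaussSymbol_le ha.le le_rfl ha1 k c x

theorem norm_gauss_mul_le (a : ℝ) (k : E d) (c : ℝ) (x : E d) {A B : ℝ}
    (hB : A ≤ B * (1 + ‖x‖) ^ 2) :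
    ‖gauss a k c x‖ * A ≤ Real.exp c * B * (1 + ‖x‖) ^ 2 * Real.exp (-a * ‖x‖ ^ 2) := by
  rw [norm_gauss, Real.exp_add]
  calc _ ≤ Real.exp (-a * ‖x‖ ^ 2) * Real.exp c * (B * (1 + ‖x‖) ^ 2) := by gcongr
    _ = _ := by ring

theorem memLp_iteratedFDeriv_gauss {a : ℝ} (ha : 0 < a) (k : E d) (c : ℝ) {n : ℕ} (hn : n ≤ 2) :
    MemLp (iteratedFDeriv ℝ n (gauss a k c)) 2 volume := by
  have hm : AEStronglyMeasurable (iteratedFDeriv ℝ n (gauss a k c)) (volume : Measure (E d)) :=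
    ((contDiff_gauss a k c (n := n)).continuous_iteratedFDeriv le_rfl).aestronglyMeasurable
  set L := 2 * |a| + ‖k‖ with hL
  have hL0 : 0 ≤ L := by positivity
  interval_cases n
  · refine (memLp_gauss ha k c).mono hm (ae_of_all _ fun x => ?_)
    rw [norm_iteratedFDeriv_zero]
  · refine memLp_of_norm_le_exp (M := Real.exp c * L) ha (by positivity) hm fun x => ?_
    rw [norm_iteratedFDeriv_one, fderiv_gauss, norm_smul]
    refine norm_gauss_mul_le a k c x ((norm_gaussPhase_le a k x).trans ?_)
    gcongr
    exact le_self_pow₀ (by linarith [norm_nonneg x]) (by norm_num)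
  -- The phase derivative is affine in `x` with constant derivative `D`. The second derivative of
  -- the packet is thus the packet times `D` plus a term quadratic in the phase derivative.
  · obtain ⟨D, hD⟩ : ∃ D : E d →L[ℝ] (E d →L[ℝ] ℂ), ∀ x, HasFDerivAt (gaussPhase a k) D x :=
      ⟨(ContinuousLinearMap.compL ℝ (E d) ℝ ℂ Complex.ofRealCLM).comp
        ((-(2 * a)) • (innerSL ℝ : E d →L[ℝ] E d →L[ℝ] ℝ)), fun x =>
        (ContinuousLinearMap.hasFDerivAt ((ContinuousLinearMap.compL ℝ (E d) ℝ ℂ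
          Complex.ofRealCLM).comp ((-(2 * a)) • (innerSL ℝ : E d →L[ℝ] E d →L[ℝ] ℝ)))).add_const _⟩
    refine memLp_of_norm_le_exp (M := Real.exp c * (‖D‖ + L ^ 2)) ha (by positivity) hm fun x => ?_
    have h2 : fderiv ℝ (fun x => gauss a k c x • gaussPhase a k x) x = _ :=
      ((hasFDerivAt_gauss a k c x).smul (hD x)).fderiv
    rw [← norm_iteratedFDeriv_fderiv, norm_iteratedFDeriv_one, fderiv_gauss, h2]
    refine (norm_add_le _ _).trans ?_
    have h3 : ‖(gauss a k c x • gaussPhase a k x).smulRight (gaussPhase a k x)‖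
        ≤ ‖gauss a k c x‖ * ‖gaussPhase a k x‖ ^ 2 := by
      refine ContinuousLinearMap.opNorm_le_bound _ (by positivity) fun v => ?_
      rw [ContinuousLinearMap.smulRight_apply, smul_apply, norm_smul, norm_smul]
      calc _ ≤ ‖gauss a k c x‖ * (‖gaussPhase a k x‖ * ‖v‖) * ‖gaussPhase a k x‖ := by
            gcongr
            exact ContinuousLinearMap.le_opNorm _ _
        _ = _ := by ring
    refine (add_le_add le_rfl h3).trans ?_
    rw [norm_smul, ← mul_add]
    refine norm_gauss_mul_le a k c x ?_
    have h4 := norm_gaussPhase_le a k x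
    have h5 : ‖gaussPhase a k x‖ ^ 2 ≤ (L * (1 + ‖x‖)) ^ 2 := by gcongr
    have h6 : ‖D‖ ≤ ‖D‖ * (1 + ‖x‖) ^ 2 :=
      le_mul_of_one_le_right (by positivity) (one_le_pow₀ (by linarith [norm_nonneg x]))
    rw [mul_pow] at h5
    linarith

end Gauss

/-! ### The evolution of Gaussian wave packets -/

section Packet

variable {d : ℕ}

/-- The width parameter at time `t` of a wave packet that evolves under the Ornstein-Uhlenbeck
semigroup. -/
def packetWidth (t : ℝ) : ℝ := (2 * Real.exp (4 * t) - 1)⁻¹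

/-- The frequency of the wave packet at time `t`, relative to the initial one. -/
def packetFreq (t : ℝ) : ℝ := Real.exp (2 * t) * packetWidth t

/-- The logarithm of the amplitude of the wave packet at time `t`. -/
def packetLogAmp (d : ℕ) (k : E d) (t : ℝ) : ℝ :=
  ‖k‖ ^ 2 / 8 * (packetWidth t - 1) - d / 2 * Real.log (2 - Real.exp (-(4 * t)))

/-- The solution of `∂ₜ u = Δ u - 2 x · ∇ u` with initial value `exp (-|x|² + i k · x)`. -/
def packet (k : E d) (t : ℝ) : E d → ℂ :=
  gauss (packetWidth t) (packetFreq t • k) (packetLogAmp d k t)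

section

variable {t : ℝ}

theorem one_lt_packetWidth_inv (ht : 0 < t) : 1 < 2 * Real.exp (4 * t) - 1 := by
  have := Real.add_one_le_exp (4 * t)
  linarith

theorem packetWidth_pos (ht : 0 < t) : 0 < packetWidth t :=
  inv_pos.2 (zero_lt_one.trans (one_lt_packetWidth_inv ht))

theorem packetWidth_le_one (ht : 0 < t) : packetWidth t ≤ 1 :=
  inv_le_one_of_one_le₀ (one_lt_packetWidth_inv ht).le

theorem packetWidth_anti {s : ℝ} (hs : 0 < s) (hst : s ≤ t) : packetWidth t ≤ packetWidth s := by
  have h := one_lt_packetWidth_inv hs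
  unfold packetWidth
  gcongr

theorem packetFreq_pos (ht : 0 < t) : 0 < packetFreq t :=
  mul_pos (Real.exp_pos _) (packetWidth_pos ht)

theorem exp_four_mul (t : ℝ) : Real.exp (4 * t) = Real.exp (2 * t) ^ 2 := by
  rw [← Real.exp_nat_mul]
  congr 1
  push_cast
  ring

theorem packetFreq_le_one (ht : 0 < t) : packetFreq t ≤ 1 := by
  have h := one_lt_packetWidth_inv ht
  rw [packetFreq, packetWidth, ← div_eq_mul_inv, div_le_one (by linarith), exp_four_mul]
  have := Real.add_one_le_exp (2 * t)
  nlinarith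

theorem packetLogAmp_le_zero (k : E d) (ht : 0 < t) : packetLogAmp d k t ≤ 0 := by
  have h1 : ‖k‖ ^ 2 / 8 * (packetWidth t - 1) ≤ 0 :=
    mul_nonpos_of_nonneg_of_nonpos (by positivity) (by linarith [packetWidth_le_one ht])
  have h2 : Real.exp (-(4 * t)) ≤ 1 := Real.exp_le_one_iff.2 (by linarith)
  have h3 : 0 ≤ Real.log (2 - Real.exp (-(4 * t))) := Real.log_nonneg (by linarith)
  have h4 : 0 ≤ (d : ℝ) / 2 * Real.log (2 - Real.exp (-(4 * t))) := by positivity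
  rw [packetLogAmp]
  linarith

/-- This equation matches the coefficient of `|x|²` in `gaussSymbol`. The reciprocal `p` of the
width solves the linear equation `p' = 4 p + 4` with initial value `1`. -/
theorem hasDerivAt_packetWidth (ht : 0 < t) :
    HasDerivAt packetWidth (-(4 * packetWidth t ^ 2 + 4 * packetWidth t)) t := by
  have h := one_lt_packetWidth_inv ht
  have h1 : HasDerivAt (fun s : ℝ => 2 * Real.exp (4 * s) - 1)
      (2 * (Real.exp (4 * t) * (4 * 1))) t :=
    (((hasDerivAt_id t).const_mul 4).exp.const_mul 2).sub_const 1
  refine (h1.inv (by linarith)).congr_deriv ?_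
  have h2 : 2 * Real.exp (4 * t) - 1 ≠ 0 := by linarith
  rw [packetWidth]
  field_simp
  ring

theorem hasDerivAt_packetFreq (ht : 0 < t) :
    HasDerivAt packetFreq (-(4 * packetWidth t + 2) * packetFreq t) t := by
  have h1 : HasDerivAt (fun s : ℝ => Real.exp (2 * s)) (Real.exp (2 * t) * (2 * 1)) t :=
    ((hasDerivAt_id t).const_mul 2).exp
  refine (h1.mul (hasDerivAt_packetWidth ht)).congr_deriv ?_
  rw [packetFreq]
  ring

/-- The terms of `gaussSymbol` independent of `x` must be integrated in time. The identity `α² + α =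
2 β²` between width `α` and frequency `β` makes `β²` equal to `-α' / 8`, and `4 α` is the derivative
of the logarithm. -/
theorem hasDerivAt_packetLogAmp (k : E d) (ht : 0 < t) :
    HasDerivAt (packetLogAmp d k)
      (-(packetFreq t ^ 2 * ‖k‖ ^ 2) - 2 * packetWidth t * d) t := by
  have h := one_lt_packetWidth_inv ht
  have h2 : Real.exp (-(4 * t)) < 1 := by
    rw [← Real.exp_zero]
    exact Real.exp_lt_exp.2 (by linarith)
  have h1 : HasDerivAt (fun s : ℝ => 2 - Real.exp (-(4 * s)))
      (-(Real.exp (-(4 * t)) * (-(4 * 1)))) t :=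
    (((hasDerivAt_id t).const_mul 4).neg.exp.const_sub 2)
  refine ((((hasDerivAt_packetWidth ht).sub_const 1).const_mul (‖k‖ ^ 2 / 8)).sub
    ((h1.log (by linarith)).const_mul ((d : ℝ) / 2))).congr_deriv ?_
  have h3 : -(Real.exp (-(4 * t)) * (-(4 * 1))) / (2 - Real.exp (-(4 * t)))
      = 4 * packetWidth t := by
    rw [Real.exp_neg, packetWidth]
    have h4 : 2 * Real.exp (4 * t) - 1 ≠ 0 := by linarith
    have h5 := (Real.exp_pos (4 * t)).ne'
    have h6 : 2 - (Real.exp (4 * t))⁻¹ ≠ 0 := by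
      rw [← Real.exp_neg]
      linarith
    field_simp
  have h4 : packetWidth t ^ 2 + packetWidth t = 2 * packetFreq t ^ 2 := by
    rw [packetFreq, mul_pow, ← exp_four_mul, packetWidth]
    have h4 : 2 * Real.exp (4 * t) - 1 ≠ 0 := by linarith
    field_simp
    ring
  rw [h3]
  linear_combination (-(‖k‖ ^ 2 / 2)) * h4

theorem hasDerivAt_packet (k : E d) (ht : 0 < t) (x : E d) :
    HasDerivAt (fun s => packet k s x) (formalOp 0 (packet k t) x) t := by
  have h1 : HasDerivAt (fun s => ((-packetWidth s * ‖x‖ ^ 2 : ℝ) : ℂ)) _ t :=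
    ((hasDerivAt_packetWidth ht).neg.mul_const (‖x‖ ^ 2)).ofReal_comp
  have h2 : HasDerivAt (fun s => ((inner ℝ (packetFreq s • k) x : ℝ) : ℂ))
      ((-(4 * packetWidth t + 2) * packetFreq t * inner ℝ k x : ℝ) : ℂ) t := by
    simp only [real_inner_smul_left]
    exact ((hasDerivAt_packetFreq ht).mul_const _).ofReal_comp
  have h3 := (hasDerivAt_packetLogAmp k ht).ofReal_comp
  have h4 := ((h1.add (h2.const_mul Complex.I)).add h3).cexp
  refine h4.congr_deriv ?_
  rw [packet, formalOp_gauss, gaussSymbol, gauss, real_inner_smul_left, norm_smul,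
    Real.norm_of_nonneg (packetFreq_pos ht).le]
  simp only [Pi.add_apply, real_inner_smul_left]
  congr 1
  push_cast
  ring

theorem memLp_packet (k : E d) (ht : 0 < t) : MemLp (packet k t) 2 volume :=
  memLp_gauss (packetWidth_pos ht) _ _

theorem memLp_formalOp_packet (k : E d) (ht : 0 < t) :
    MemLp (formalOp 0 (packet k t)) 2 volume :=
  memLp_formalOp_gauss (packetWidth_pos ht) (packetWidth_le_one ht) _ _

/-- The amplitude is at most one, so only the spreading of the Gaussian counts. Its reciprocal width
grows like `e^{4t}`, which gives the growth `e^{dt}` of the `L²` norm and the threshold `Re z > d`.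
-/
theorem integral_norm_packet_sq_le (k : E d) (ht : 0 < t) :
    ∫ x, ‖packet k t x‖ ^ 2 ≤ Real.pi ^ ((d : ℝ) / 2) * Real.exp (d * t) ^ 2 := by
  have hα := packetWidth_pos ht
  have hg := GaussianFourier.integral_rexp_neg_mul_sq_norm (V := E d)
    (b := 2 * packetWidth t) (by positivity)
  have hgi : Integrable fun x : E d => Real.exp (-(2 * packetWidth t) * ‖x‖ ^ 2) := by
    refine ((memLp_exp_neg_mul_sq (d := d) hα).integrable_norm_pow (by norm_num)).congr
      (ae_of_all _ fun x => ?_)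
    simp only
    rw [Real.norm_of_nonneg (Real.exp_pos _).le, ← Real.exp_nat_mul]
    congr 1
    push_cast
    ring
  have h1 : ∫ x, ‖packet k t x‖ ^ 2 ≤ ∫ x : E d, Real.exp (-(2 * packetWidth t) * ‖x‖ ^ 2) := by
    refine integral_mono ((memLp_packet k ht).integrable_norm_pow (by norm_num)) hgi fun x => ?_
    simp only
    rw [packet, norm_gauss, ← Real.exp_nat_mul]
    have := packetLogAmp_le_zero k ht
    refine Real.exp_le_exp.2 ?_
    push_cast
    linarith
  refine h1.trans ?_
  rw [hg, finrank_euclideanSpace_fin]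
  have h2 : Real.pi / (2 * packetWidth t) ≤ Real.pi * Real.exp (4 * t) := by
    rw [packetWidth]
    have h := one_lt_packetWidth_inv ht
    have h3 : Real.pi / (2 * (2 * Real.exp (4 * t) - 1)⁻¹)
        = Real.pi * ((2 * Real.exp (4 * t) - 1) / 2) := by
      field_simp
    rw [h3]
    have := Real.pi_pos
    gcongr
    linarith
  calc (Real.pi / (2 * packetWidth t)) ^ ((d : ℝ) / 2)
      ≤ (Real.pi * Real.exp (4 * t)) ^ ((d : ℝ) / 2) :=
        Real.rpow_le_rpow (by positivity) h2 (by positivity)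
    _ = _ := by
      rw [Real.mul_rpow Real.pi_pos.le (Real.exp_pos _).le, ← Real.exp_mul, ← Real.exp_nat_mul]
      congr 2
      push_cast
      ring

end

/-! ### Totality of the wave packets and of their images under `z - L₀`. -/

theorem hasDerivAt_integral_packet_mul {G : E d → ℂ} (hG : MemLp G 2 volume) (k : E d) {t : ℝ}
    (ht : 0 < t) :
    HasDerivAt (fun s => ∫ x, packet k s x * G x) (∫ x, formalOp 0 (packet k t) x * G x) t := by
  -- The width parameter decreases in time, so its value at `t + 1` bounds it from below on the
  -- whole neighbourhood `(0, t + 1)`.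
  set m := packetWidth (t + 1) with hm
  have hm0 : 0 < m := packetWidth_pos (by linarith)
  set B := 8 + 6 * ‖k‖ + ‖k‖ ^ 2 + 2 * (d : ℝ) with hB
  have hB0 : 0 ≤ B := by positivity
  have hs : Ioo 0 (t + 1) ∈ 𝓝 t := Ioo_mem_nhds ht (by linarith)
  have hdom : MemLp (fun x : E d => B * (1 + ‖x‖) ^ 2 * Real.exp (-m * ‖x‖ ^ 2)) 2 volume := by
    refine memLp_of_norm_le_exp (M := B) hm0 hB0
      (by fun_prop : Continuous _).aestronglyMeasurable fun x => le_of_eq ?_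
    rw [Real.norm_of_nonneg (by positivity)]
  refine (hasDerivAt_integral_of_dominated_loc_of_deriv_le (μ := (volume : Measure (E d)))
    (F := fun s x => packet k s x * G x) (F' := fun s x => formalOp 0 (packet k s) x * G x)
    (bound := fun x => B * (1 + ‖x‖) ^ 2 * Real.exp (-m * ‖x‖ ^ 2) * ‖G x‖) hs ?_ ?_ ?_ ?_ ?_ ?_).2
  · filter_upwards [lt_mem_nhds ht] with s hs0
    exact (memLp_packet k hs0).1.mul hG.1
  · exact (memLp_packet k ht).integrable_mul hG
  · exact (memLp_formalOp_packet k ht).1.mul hG.1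
  · refine ae_of_all _ fun x s hs => ?_
    rw [norm_mul]
    gcongr
    rw [packet, formalOp_gauss]
    have hβ := packetFreq_le_one hs.1
    have hβ0 := (packetFreq_pos hs.1).le
    refine (norm_gauss_mul_gaussSymbol_le (packetWidth_pos hs.1).le
      (packetWidth_anti hs.1 hs.2.le) (packetWidth_le_one hs.1) _ _ x).trans ?_
    have hk : ‖packetFreq s • k‖ ≤ ‖k‖ := by
      rw [norm_smul, Real.norm_of_nonneg hβ0]
      exact mul_le_of_le_one_left (norm_nonneg k) hβ
    have he : Real.exp (packetLogAmp d k s) ≤ 1 :=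
      Real.exp_le_one_iff.2 (packetLogAmp_le_zero k hs.1)
    calc _ ≤ 1 * (8 + 6 * ‖k‖ + ‖k‖ ^ 2 + 2 * d) * (1 + ‖x‖) ^ 2 * Real.exp (-m * ‖x‖ ^ 2) := by
          gcongr
      _ = _ := by rw [one_mul]
  · exact hdom.integrable_mul hG.norm
  · refine ae_of_all _ fun x s hs => ?_
    exact (hasDerivAt_packet k hs.1 x).mul_const (G x)

/-- Orthogonality makes the pairing a multiple of `e^{zt}`, while Cauchy–Schwarz-type bounds allow
growth of order `e^{dt}` only. Since `Re z > d`, the multiple is zero. -/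
theorem integral_packet_mul_eq_zero {G : E d → ℂ} (hG : MemLp G 2 volume) {z : ℂ}
    (hz : (d : ℝ) < z.re) (k : E d)
    (h : ∀ t, 0 < t → ∫ x, (z * packet k t x - formalOp 0 (packet k t) x) * G x = 0) :
    ∫ x, packet k 1 x * G x = 0 := by
  set H : ℝ → ℂ := fun s => ∫ x, packet k s x * G x with hH
  have hderiv : ∀ t, 0 < t → HasDerivAt H (z * H t) t := by
    intro t ht
    refine (hasDerivAt_integral_packet_mul hG k ht).congr_deriv ?_
    have h1 := h t ht
    simp only [sub_mul, mul_assoc] at h1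
    have i1 : Integrable fun x => packet k t x * G x := (memLp_packet k ht).integrable_mul hG
    have i2 : Integrable fun x => formalOp 0 (packet k t) x * G x :=
      (memLp_formalOp_packet k ht).integrable_mul hG
    rw [integral_sub (i1.const_mul z) i2, integral_const_mul, sub_eq_zero] at h1
    exact h1.symm
  have hconst : ∀ T : ℝ, 1 ≤ T → Complex.exp (-(z * T)) * H T = Complex.exp (-(z * (1 : ℝ))) * H 1 := by
    intro T hT
    have hd : ∀ t : ℝ, 0 < t →
        HasDerivAt (fun s : ℝ => Complex.exp (-(z * s)) * H s) 0 t := by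
      intro t ht
      have h1 : HasDerivAt (fun s : ℝ => Complex.exp (-(z * s)))
          (Complex.exp (-(z * t)) * (-(z * 1))) t :=
        ((Complex.ofRealCLM.hasDerivAt (x := t)).const_mul z).neg.cexp
      refine (h1.mul (hderiv t ht)).congr_deriv ?_
      ring
    exact constant_of_has_deriv_right_zero (a := 1) (b := T)
      (fun s hs => (hd s (by linarith [hs.1])).continuousAt.continuousWithinAt)
      (fun s hs => (hd s (by linarith [hs.1])).hasDerivWithinAt) T ⟨hT, le_rfl⟩
  have hbound : ∃ M : ℝ, ∀ t, 0 < t → ‖H t‖ ≤ M * Real.exp (d * t) := by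
    -- Young's inequality with parameter `e = exp (d t)` balances the squared packet norm, of order
    -- `e²`, against the fixed norm of `G`.
    refine ⟨(Real.pi ^ ((d : ℝ) / 2) + ∫ x, ‖G x‖ ^ 2) / 2, fun t ht => ?_⟩
    set e := Real.exp (d * t) with he
    have he0 : 0 < e := Real.exp_pos _
    have ip : Integrable fun x => ‖packet k t x‖ ^ 2 :=
      (memLp_packet k ht).integrable_norm_pow (by norm_num)
    have iG : Integrable fun x => ‖G x‖ ^ 2 := hG.integrable_norm_pow (by norm_num)
    have h1 : ‖H t‖ ≤ ∫ x, (‖packet k t x‖ ^ 2 / (2 * e) + e / 2 * ‖G x‖ ^ 2) := by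
      refine norm_integral_le_of_norm_le ((ip.div_const _).add (iG.const_mul _))
        (ae_of_all _ fun x => ?_)
      rw [norm_mul]
      have : ‖packet k t x‖ ^ 2 / (2 * e) + e / 2 * ‖G x‖ ^ 2 - ‖packet k t x‖ * ‖G x‖
          = (‖packet k t x‖ - e * ‖G x‖) ^ 2 / (2 * e) := by
        field_simp
        ring
      have h2 : 0 ≤ (‖packet k t x‖ - e * ‖G x‖) ^ 2 / (2 * e) := by positivity
      linarith
    rw [integral_add (ip.div_const _) (iG.const_mul _), integral_div, integral_const_mul] at h1
    have h2 : (∫ x, ‖packet k t x‖ ^ 2) / (2 * e) ≤ Real.pi ^ ((d : ℝ) / 2) * e / 2 := by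
      rw [div_le_iff₀ (by positivity)]
      have := integral_norm_packet_sq_le k ht
      linarith
    linarith
  obtain ⟨M, hM⟩ := hbound
  have hlim : Tendsto (fun T : ℝ => M * Real.exp (-((z.re - d) * T))) atTop (𝓝 (M * 0)) := by
    refine (Real.tendsto_exp_neg_atTop_nhds_zero.comp ?_).const_mul M
    exact tendsto_id.const_mul_atTop (sub_pos.2 hz)
  have hle : ‖Complex.exp (-(z * (1 : ℝ))) * H 1‖ ≤ M * 0 := by
    refine ge_of_tendsto hlim ?_
    filter_upwards [eventually_ge_atTop 1] with T hT
    rw [← hconst T hT, norm_mul, Complex.norm_exp]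
    calc _ ≤ Real.exp (-(z * T)).re * (M * Real.exp (d * T)) := by
          gcongr
          exact hM T (by linarith)
      _ = _ := by
          rw [mul_left_comm, ← Real.exp_add]
          congr 2
          simp
          ring
  rw [mul_zero, norm_le_zero_iff, mul_eq_zero] at hle
  exact hle.resolve_left (Complex.exp_ne_zero _)

/-- A function in `L²` that is orthogonal to all Gaussian wave packets of a fixed width vanishes. -/
theorem ae_eq_zero_of_integral_gauss_mul {G : E d → ℂ} (hG : MemLp G 2 volume) {a : ℝ} (ha : 0 < a)
    (h : ∀ k, ∫ x, gauss a k 0 x * G x = 0) : G =ᵐ[volume] 0 := by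
  set f : E d → ℂ := fun x => gauss a 0 0 x * G x with hf
  have hfi : Integrable f := (memLp_gauss ha 0 0).integrable_mul hG
  have hF : ∀ w, 𝓕 f w = 0 := by
    intro w
    rw [Real.fourier_eq', ← h ((-(2 * Real.pi)) • w)]
    refine integral_congr_ae (ae_of_all _ fun x => ?_)
    simp only [hf, smul_eq_mul]
    rw [← mul_assoc, gauss, gauss, ← Complex.exp_add]
    congr 2
    rw [real_inner_smul_left, real_inner_comm w x]
    simp
    ring
  -- Uniqueness for the Fourier transform on `L¹` by duality: a test function is `𝓕 ψ` with `ψ`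
  -- Schwartz, and `∫ (𝓕 ψ) f = ∫ ψ (𝓕 f) = 0`.
  have h0 : ∀ᵐ x, f x = 0 := by
    refine ae_eq_zero_of_integral_contDiff_smul_eq_zero hfi.locallyIntegrable fun g hg hgc => ?_
    have hg' : ContDiff ℝ ((⊤ : ℕ∞) : WithTop ℕ∞) (fun x => (g x : ℂ)) :=
      Complex.ofRealCLM.contDiff.comp hg
    have hgc' : HasCompactSupport (fun x => (g x : ℂ)) := hgc.comp_left Complex.ofReal_zero
    let φ : SchwartzMap (E d) ℂ := hgc'.toSchwartzMap hg'
    have hφ : ∀ x, φ x = g x := fun x => rfl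
    let ψ : SchwartzMap (E d) ℂ := 𝓕⁻ φ
    have hψ : 𝓕 ψ = φ := FourierTransform.fourier_fourierInv_eq φ
    have key := VectorFourier.integral_fourierIntegral_smul_eq_flip (L := innerₗ (E d))
      (μ := volume) (ν := volume) (f := ψ) (g := f) Real.continuous_fourierChar
      (by exact continuous_inner) ψ.integrable hfi
    have e1 : ∀ x, VectorFourier.fourierIntegral Real.fourierChar volume (innerₗ (E d)) ψ x
        = g x := by
      intro x
      rw [← hφ, ← hψ, SchwartzMap.fourier_coe]
      rfl
    have e2 : ∀ x, VectorFourier.fourierIntegral Real.fourierChar volume (innerₗ (E d)).flip f x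
        = 0 := by
      intro x
      rw [← hF x, flip_innerₗ]
      rfl
    simp only [e1, e2, smul_zero, integral_zero] at key
    rw [← key]
    refine integral_congr_ae (ae_of_all _ fun x => ?_)
    simp
  filter_upwards [h0] with x hx
  exact (mul_eq_zero.1 hx).resolve_left (Complex.exp_ne_zero _)

theorem ae_eq_zero_of_orthogonal_gauss {G : E d → ℂ} (hG : MemLp G 2 volume) {z : ℂ}
    (hz : (d : ℝ) < z.re)
    (h : ∀ (a : ℝ) (k : E d) (c : ℝ), 0 < a → a ≤ 1 →
      ∫ x, (z * gauss a k c x - formalOp 0 (gauss a k c) x) * G x = 0) : G =ᵐ[volume] 0 := by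
  refine ae_eq_zero_of_integral_gauss_mul hG (packetWidth_pos one_pos) fun k => ?_
  -- The initial frequency that the evolution carries to `k` at time `1`; all packets have the same
  -- width then.
  set k' := (packetFreq 1)⁻¹ • k
  have h1 := integral_packet_mul_eq_zero hG hz k' fun t ht =>
    h _ _ _ (packetWidth_pos ht) (packetWidth_le_one ht)
  have h2 : packetFreq 1 • k' = k := smul_inv_smul₀ (packetFreq_pos one_pos).ne' k
  have h3 : ∀ x, packet k' 1 x * G x
      = Complex.exp (packetLogAmp d k' 1) * (gauss (packetWidth 1) k 0 x * G x) := by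
    intro x
    rw [packet, h2, gauss, gauss, Complex.exp_add]
    simp
    ring
  simp only [h3] at h1
  rw [integral_const_mul, mul_eq_zero] at h1
  exact h1.resolve_left (Complex.exp_ne_zero _)

end Packet

/-! ### The resolvent of the perturbed Ornstein-Uhlenbeck operator -/

section Resolvent

variable {d : ℕ}

theorem L2_norm_sq_eq {f : L2 d} {F : E d → ℂ} (h : (f : E d → ℂ) =ᵐ[volume] F) :
    ‖f‖ ^ 2 = ∫ x, ‖F x‖ ^ 2 := by
  have h1 : (inner ℂ f f : ℂ) = ((∫ x, ‖F x‖ ^ 2 : ℝ) : ℂ) := by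
    rw [L2.inner_def, ← integral_complex_ofReal]
    refine integral_congr_ae ?_
    filter_upwards [h] with x hx
    rw [hx, inner_self_eq_norm_sq_to_K]
    push_cast
    rfl
  rw [inner_self_eq_norm_sq_to_K] at h1
  refine Complex.ofReal_injective ?_
  rw [Complex.ofReal_pow]
  exact h1

theorem L2_eq_zero_of_gauss {g : L2 d} {z : ℂ} (hz : (d : ℝ) < z.re)
    (h : ∀ (a : ℝ) (k : E d) (c : ℝ), 0 < a → a ≤ 1 →
      ∫ x, (z * gauss a k c x - formalOp 0 (gauss a k c) x) * conj (g x) = 0) : g = 0 := by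
  have h0 := ae_eq_zero_of_orthogonal_gauss (Lp.memLp g).star hz h
  rw [Lp.eq_zero_iff_ae_eq_zero]
  filter_upwards [h0] with x hx
  exact star_eq_zero.1 hx

theorem L2_eq_zero_of_orthogonal_gauss {g : L2 d}
    (h : ∀ k : E d, ∫ x, gauss 1 k 0 x * conj (g x) = 0) : g = 0 := by
  have h0 := ae_eq_zero_of_integral_gauss_mul (Lp.memLp g).star one_pos h
  rw [Lp.eq_zero_iff_ae_eq_zero]
  filter_upwards [h0] with x hx
  exact star_eq_zero.1 hx

theorem IsAdmissible.isSobolev {V : ℝ → ℂ} {u : E d → ℂ} (hu : IsAdmissible V u) :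
    IsSobolev u := by
  have h2 : ContDiff ℝ 2 u := hu.smooth.of_le (natCast_le_infty 2)
  have hd1 : ContDiff ℝ 1 (fderiv ℝ u) := h2.fderiv_right (by norm_num)
  have hd : Differentiable ℝ (fderiv ℝ u) := hd1.differentiable (by norm_num)
  refine ⟨h2, ?_, fun j => ?_, fun j => ?_⟩
  · refine (hu.sobolev 0 (by norm_num)).mono h2.continuous.aestronglyMeasurable
      (ae_of_all _ fun x => ?_)
    rw [norm_iteratedFDeriv_zero]
  · refine (hu.sobolev 1 (by norm_num)).mono
      (hd1.continuous.clm_apply continuous_const).aestronglyMeasurable (ae_of_all _ fun x => ?_)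
    rw [norm_iteratedFDeriv_one]
    simpa using (fderiv ℝ u x).le_opNorm (stdVec j)
  · have e : (fun x => fderiv ℝ (fun y => fderiv ℝ u y (stdVec j)) x (stdVec j))
        = fun x => iteratedFDeriv ℝ 2 u x ![stdVec j, stdVec j] := by
      funext x
      rw [iteratedFDeriv_two_apply, fderiv_clm_apply (hd x) (differentiableAt_const _)]
      simp
    have hc : Continuous fun x => fderiv ℝ (fun y => fderiv ℝ u y (stdVec j)) x (stdVec j) :=
      ((hd1.clm_apply contDiff_const).continuous_fderiv (by norm_num)).clm_apply continuous_const
    rw [e] at hc ⊢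
    refine (hu.sobolev 2 le_rfl).mono hc.aestronglyMeasurable (ae_of_all _ fun x => ?_)
    simpa using (iteratedFDeriv ℝ 2 u x).le_opNorm ![stdVec j, stdVec j]

/-- The assumptions on the potential that enter the resolvent estimate. -/
structure IsDecaying (V : ℝ → ℂ) (K : ℝ) : Prop where
  continuousOn : ContinuousOn V (Ici 0)
  norm_le : ∀ r : ℝ, 0 ≤ r → ‖V r‖ ≤ K * (1 + r ^ 2)⁻¹

variable {V : ℝ → ℂ} {K : ℝ}

theorem IsDecaying.nonneg (hV : IsDecaying V K) : 0 ≤ K := by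
  have := (norm_nonneg _).trans (hV.norm_le 0 le_rfl)
  simpa using this

theorem IsDecaying.norm_le_weight (hV : IsDecaying V K) (x : E d) : ‖V ‖x‖‖ ≤ K * weight 1 x := by
  rw [weight, one_mul]
  exact hV.norm_le ‖x‖ (norm_nonneg x)

theorem IsDecaying.norm_le_const (hV : IsDecaying V K) (x : E d) : ‖V ‖x‖‖ ≤ K :=
  (hV.norm_le_weight x).trans (mul_le_of_le_one_right hV.nonneg (weight_le_one zero_le_one x))

theorem IsDecaying.continuous_comp_norm (hV : IsDecaying V K) :
    Continuous fun x : E d => V ‖x‖ :=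
  hV.continuousOn.comp_continuous continuous_norm fun x => norm_nonneg x

theorem IsDecaying.memLp_mul (hV : IsDecaying V K) {u : E d → ℂ} (hu : MemLp u 2 volume) :
    MemLp (fun x => V ‖x‖ * u x) 2 volume := by
  refine (hu.const_mul (K : ℂ)).mono
    (hV.continuous_comp_norm.aestronglyMeasurable.mul hu.1) (ae_of_all _ fun x => ?_)
  rw [norm_mul, norm_mul, Complex.norm_real, Real.norm_of_nonneg hV.nonneg]
  gcongr
  exact hV.norm_le_const x

theorem formalOp_eq_add (V : ℝ → ℂ) (u : E d → ℂ) :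
    formalOp V u = formalOp 0 u + fun x => V ‖x‖ * u x := by
  funext x
  rw [Pi.add_apply, formalOp_zero_apply, formalOp]

theorem IsAdmissible.memLp {u : E d → ℂ} (hu : IsAdmissible V u) : MemLp u 2 volume :=
  hu.isSobolev.memLp

/-- Multiplication by the bounded function `V` preserves `L²`, so the free expression is available
on the domain of the perturbed operator. -/
theorem IsAdmissible.free (hV : IsDecaying V K) {u : E d → ℂ} (hu : IsAdmissible V u) :
    IsAdmissible 0 u := by
  refine ⟨hu.smooth, hu.sobolev, ?_⟩
  have := hu.memLp_op.sub (hV.memLp_mul hu.memLp)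
  rwa [formalOp_eq_add, add_sub_cancel_right] at this

theorem isAdmissible_gauss (hV : IsDecaying V K) {a : ℝ} (ha : 0 < a) (ha1 : a ≤ 1) (k : E d)
    (c : ℝ) : IsAdmissible V (gauss a k c) := by
  refine ⟨contDiff_gauss a k c, fun n hn => memLp_iteratedFDeriv_gauss ha k c hn, ?_⟩
  rw [formalOp_eq_add]
  exact (memLp_formalOp_gauss ha ha1 k c).add (hV.memLp_mul (memLp_gauss ha k c))

theorem preOp_ae_eq (f : preDomain d V) {u : E d → ℂ} (hu : IsAdmissible V u)
    (h : (f : L2 d) =ᵐ[volume] u) : (preOp d V f : E d → ℂ) =ᵐ[volume] formalOp V u := by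
  rw [← rep_unique f hu h]
  exact (rep_admissible f).memLp_op.coeFn_toLp

theorem preDomain_le_free (hV : IsDecaying V K) : preDomain d V ≤ preDomain d 0 := by
  rintro f ⟨u, hu, hf⟩
  exact ⟨u, hu.free hV, hf⟩

/-- The unperturbed operator on the domain of the perturbed one. -/
def freeOp (hV : IsDecaying V K) : preDomain d V →ₗ[ℂ] L2 d :=
  (preOp d 0).toFun.comp (Submodule.inclusion (preDomain_le_free hV))

theorem freeOp_ae_eq (hV : IsDecaying V K) (f : preDomain d V) {u : E d → ℂ}
    (hu : IsAdmissible V u) (h : (f : L2 d) =ᵐ[volume] u) :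
    (freeOp hV f : E d → ℂ) =ᵐ[volume] formalOp 0 u :=
  preOp_ae_eq (Submodule.inclusion (preDomain_le_free hV) f) (hu.free hV) h

theorem smul_sub_freeOp_ae_eq (hV : IsDecaying V K) (z : ℂ) (f : preDomain d V) {u : E d → ℂ}
    (hu : IsAdmissible V u) (h : (f : L2 d) =ᵐ[volume] u) :
    ((z • (f : L2 d) - freeOp hV f : L2 d) : E d → ℂ)
      =ᵐ[volume] fun x => z * u x - formalOp 0 u x := by
  filter_upwards [Lp.coeFn_sub (z • (f : L2 d)) (freeOp hV f), Lp.coeFn_smul z (f : L2 d), h,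
    freeOp_ae_eq hV f hu h] with x h1 h2 h3 h4
  rw [h1, Pi.sub_apply, h2, Pi.smul_apply, h3, h4, smul_eq_mul]

theorem preOp_sub_freeOp_ae_eq (hV : IsDecaying V K) (f : preDomain d V) {u : E d → ℂ}
    (hu : IsAdmissible V u) (h : (f : L2 d) =ᵐ[volume] u) :
    ((preOp d V f - freeOp hV f : L2 d) : E d → ℂ) =ᵐ[volume] fun x => V ‖x‖ * u x := by
  filter_upwards [Lp.coeFn_sub (preOp d V f) (freeOp hV f), preOp_ae_eq f hu h,
    freeOp_ae_eq hV f hu h] with x h1 h2 h3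
  rw [h1, Pi.sub_apply, h2, h3, formalOp_eq_add, Pi.add_apply, add_sub_cancel_left]

theorem memLp_resolvent_rhs (hV : IsDecaying V K) (z : ℂ) {u : E d → ℂ} (hu : IsAdmissible V u) :
    MemLp (fun x => z * u x - formalOp 0 u x) 2 volume :=
  (hu.memLp.const_mul z).sub (hu.free hV).memLp_op

/-! ### A priori estimates on the domain. -/

theorem mul_norm_le_norm_smul_sub_freeOp (hV : IsDecaying V K) {z : ℂ} {b : ℝ} (hb : 0 < b)
    (hz : z.re = d + b) (f : preDomain d V) :
    b * ‖(f : L2 d)‖ ≤ ‖z • (f : L2 d) - freeOp hV f‖ := by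
  have hu := rep_admissible f
  have h := hu.isSobolev.sq_mul_integral_le hb hz (memLp_resolvent_rhs hV z hu)
  rw [← L2_norm_sq_eq (rep_ae_eq f),
    ← L2_norm_sq_eq (smul_sub_freeOp_ae_eq hV z f hu (rep_ae_eq f)), ← mul_pow] at h
  exact (pow_le_pow_iff_left₀ (by positivity) (norm_nonneg _) two_ne_zero).1 h

theorem norm_preOp_sub_freeOp_le (hV : IsDecaying V K) (f : preDomain d V) :
    ‖preOp d V f - freeOp hV f‖ ≤ K * ‖(f : L2 d)‖ := by
  have hu := rep_admissible f
  refine Lp.norm_le_mul_norm_of_ae_le_mul ?_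
  filter_upwards [preOp_sub_freeOp_ae_eq hV f hu (rep_ae_eq f), rep_ae_eq f] with x h1 h2
  rw [h1, h2, norm_mul]
  gcongr
  exact hV.norm_le_const x

/-- The potential is small relative to the unperturbed operator at high frequencies. -/
theorem im_mul_norm_preOp_sub_freeOp_sq_le (hV : IsDecaying V K) {z : ℂ} {b : ℝ} (hb : 0 < b)
    (hz : z.re = d + b) (hz' : 0 ≤ z.im) (f : preDomain d V) :
    z.im * ‖preOp d V f - freeOp hV f‖ ^ 2
      ≤ K ^ 2 * (1 / 2 + 3 / (2 * b ^ 2) + 1 / (2 * b)) * ‖z • (f : L2 d) - freeOp hV f‖ ^ 2 := by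
  have hu := rep_admissible f
  have h := hu.isSobolev.im_mul_integral_weight_le hb hz hz' (memLp_resolvent_rhs hV z hu)
  rw [← L2_norm_sq_eq (smul_sub_freeOp_ae_eq hV z f hu (rep_ae_eq f))] at h
  rw [L2_norm_sq_eq (preOp_sub_freeOp_ae_eq hV f hu (rep_ae_eq f))]
  have hK := hV.nonneg
  have iw : Integrable fun x : E d => weight 1 x * ‖rep f x‖ ^ 2 := by
    refine hu.isSobolev.integrable_norm_sq.bdd_mul (c := 1)
      (continuous_weight zero_le_one).aestronglyMeasurable (ae_of_all _ fun x => ?_)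
    rw [Real.norm_of_nonneg (weight_pos zero_le_one x).le]
    exact weight_le_one zero_le_one x
  have h1 : ∫ x, ‖V ‖x‖ * rep f x‖ ^ 2 ≤ K ^ 2 * ∫ x, weight 1 x * ‖rep f x‖ ^ 2 := by
    rw [← integral_const_mul]
    refine integral_mono ((hV.memLp_mul hu.memLp).integrable_norm_pow (by norm_num))
      (iw.const_mul _) fun x => ?_
    have hw := weight_pos zero_le_one x
    have hw1 := weight_le_one zero_le_one x
    simp only
    rw [norm_mul, mul_pow, ← mul_assoc]
    gcongr
    -- Only one of the two available powers of the weight is needed.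
    calc ‖V ‖x‖‖ ^ 2 ≤ (K * weight 1 x) ^ 2 := by
          gcongr
          exact hV.norm_le_weight x
      _ = K ^ 2 * (weight 1 x * weight 1 x) := by ring
      _ ≤ K ^ 2 * (1 * weight 1 x) := by gcongr
      _ = _ := by rw [one_mul]
  calc _ ≤ z.im * (K ^ 2 * ∫ x, weight 1 x * ‖rep f x‖ ^ 2) := by gcongr
    _ = K ^ 2 * (z.im * ∫ x, weight 1 x * ‖rep f x‖ ^ 2) := by ring
    _ ≤ _ := by
      rw [mul_assoc]
      gcongr

/-! ### Density, closability and the full resolvent. -/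

theorem L2_inner_eq {g f : L2 d} {F : E d → ℂ} (h : (f : E d → ℂ) =ᵐ[volume] F) :
    (inner ℂ g f : ℂ) = ∫ x, F x * conj (g x) := by
  rw [L2.inner_def]
  refine integral_congr_ae ?_
  filter_upwards [h] with x hx
  rw [hx, RCLike.inner_apply]

theorem dense_preDomain (hV : IsDecaying V K) : Dense (preDomain d V : Set (L2 d)) := by
  rw [Submodule.dense_iff_topologicalClosure_eq_top, Submodule.topologicalClosure_eq_top_iff,
    Submodule.eq_bot_iff]
  intro g hg
  rw [Submodule.mem_orthogonal'] at hg
  refine L2_eq_zero_of_orthogonal_gauss fun k => ?_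
  have hu := isAdmissible_gauss hV one_pos le_rfl k 0
  rw [← hg (hu.memLp.toLp _) ⟨_, hu, hu.memLp.coeFn_toLp⟩]
  exact (L2_inner_eq hu.memLp.coeFn_toLp).symm

theorem dense_range_smul_sub_freeOp (hV : IsDecaying V K) {z : ℂ} (hz : (d : ℝ) < z.re) :
    Dense (range fun f : preDomain d V => z • (f : L2 d) - freeOp hV f) := by
  have e : (range fun f : preDomain d V => z • (f : L2 d) - freeOp hV f)
      = (LinearMap.range (z • (preDomain d V).subtype - freeOp hV) : Set (L2 d)) := rfl
  rw [e, Submodule.dense_iff_topologicalClosure_eq_top, Submodule.topologicalClosure_eq_top_iff,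
    Submodule.eq_bot_iff]
  intro g hg
  rw [Submodule.mem_orthogonal'] at hg
  refine L2_eq_zero_of_gauss hz fun a k c ha ha1 => ?_
  have hu := isAdmissible_gauss hV ha ha1 k c
  have hg' := hg _ ⟨⟨hu.memLp.toLp _, _, hu, hu.memLp.coeFn_toLp⟩, rfl⟩
  rw [← hg']
  exact (L2_inner_eq (smul_sub_freeOp_ae_eq hV z _ hu hu.memLp.coeFn_toLp)).symm

/-- The free operator is dissipative after a shift by `d`, and the bounded potential costs a further
`K`. -/
theorem isClosable_preOp (hV : IsDecaying V K) : (preOp d V).IsClosable := by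
  refine isClosable_of_dissipative (dense_preDomain hV) (d + K) fun μ hμ f => ?_
  have hK := hV.nonneg
  have h1 := mul_norm_le_norm_smul_sub_freeOp hV (z := (μ : ℂ)) (b := μ - d) (by linarith)
    (by simp) f
  have h2 := norm_preOp_sub_freeOp_le hV f
  have h3 : (μ : ℂ) • (f : L2 d) - freeOp hV f
      = ((μ : ℂ) • (f : L2 d) - preOp d V f) + (preOp d V f - freeOp hV f) := by abel
  rw [h3] at h1
  have h4 := h1.trans (norm_add_le _ _)
  linarith

/-- The factor `4` in the threshold makes the relative bound of the potential `1/2`. Then `b ‖u‖ ≤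
‖(z - L₀) u‖ ≤ 2 ‖(z - L) u‖`, whence `2 / b`. -/
theorem exists_isResolventAt_op (hV : IsDecaying V K) {z : ℂ} {b : ℝ} (hb : 0 < b)
    (hz : z.re = d + b) (hz0 : 0 < z.im)
    (hz' : 4 * (K ^ 2 * (1 / 2 + 3 / (2 * b ^ 2) + 1 / (2 * b))) ≤ z.im) :
    ∃ R : L2 d →L[ℂ] L2 d, IsResolventAt (op d V) z R ∧ ‖R‖ ≤ 2 / b := by
  have hB : ∀ f : preDomain d V,
      ‖preOp d V f - freeOp hV f‖ ≤ 1 / 2 * ‖z • (f : L2 d) - freeOp hV f‖ := by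
    intro f
    have h := im_mul_norm_preOp_sub_freeOp_sq_le hV hb hz hz0.le f
    have h1 : z.im * ‖preOp d V f - freeOp hV f‖ ^ 2
        ≤ z.im * (1 / 2 * ‖z • (f : L2 d) - freeOp hV f‖) ^ 2 := by
      nlinarith [mul_le_mul_of_nonneg_right hz' (sq_nonneg ‖z • (f : L2 d) - freeOp hV f‖)]
    exact (pow_le_pow_iff_left₀ (norm_nonneg _) (by positivity) two_ne_zero).1
      (le_of_mul_le_mul_left h1 hz0)
  refine exists_isResolventAt_closure (isClosable_preOp hV) (by positivity) (fun f => ?_)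
    (dense_range_of_perturbation (A' := freeOp hV) (q := 1 / 2) (by norm_num) (by norm_num) hB
      (dense_range_smul_sub_freeOp hV (by linarith)))
  have h1 := mul_norm_le_norm_smul_sub_freeOp hV hb hz f
  have h2 := hB f
  have h3 : z • (f : L2 d) - freeOp hV f
      = (z • (f : L2 d) - preOp d V f) + (preOp d V f - freeOp hV f) := by abel
  have h4 := norm_add_le (z • (f : L2 d) - preOp d V f) (preOp d V f - freeOp hV f)
  rw [← h3] at h4
  rw [div_mul_eq_mul_div, le_div_iff₀ hb]
  linarith

/-! ### Reduction to the full resolvent. -/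

theorem norm_opQ_le {ℓ : ℕ} (Y : SphericalHarmonic d ℓ) : ‖opQ Y‖ ≤ 1 :=
  LinearMap.mkContinuous_norm_le _ zero_le_one _

theorem norm_opP_le {ℓ : ℕ} (Y : SphericalHarmonic d ℓ) : ‖opP Y‖ ≤ 1 :=
  LinearMap.mkContinuous_norm_le _ zero_le_one _

theorem norm_reducedResolvent_le {ℓ : ℕ} (V : ℝ → ℂ) (Y : SphericalHarmonic d ℓ) (z : ℂ) :
    ‖reducedResolvent V Y z‖ ≤ ‖resolvent (op d V) z‖ := by
  refine (ContinuousLinearMap.opNorm_comp_le _ _).trans ?_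
  have h1 := ContinuousLinearMap.opNorm_comp_le (resolvent (op d V) z) (opQ Y)
  have h2 : ‖resolvent (op d V) z‖ * ‖opQ Y‖ ≤ ‖resolvent (op d V) z‖ :=
    mul_le_of_le_one_right (norm_nonneg _) (norm_opQ_le Y)
  exact (mul_le_of_le_one_left (norm_nonneg _) (norm_opP_le Y)).trans (h1.trans h2)

end Resolvent

end OrnsteinUhlenbeck

end

theorem theorem2p5 (d : ℕ) (hd : 2 ≤ d) (V : ℝ → ℂ) (K : ℝ)
    (hVdiff : DifferentiableOn ℝ V (Set.Ici 0))
    (hV : ∀ r : ℝ, 0 ≤ r → ‖V r‖ ≤ K * (Real.sqrt (1 + r ^ 2) ^ 2)⁻¹)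
    (hV' : ∀ r : ℝ, 0 ≤ r → ‖derivWithin V (Set.Ici 0) r‖ ≤ K * (Real.sqrt (1 + r ^ 2) ^ 3)⁻¹)
    (b : ℝ) (hb : 0 < b) :
    ∃ C ω₀ : ℝ, ∀ ω : ℝ, ω₀ ≤ ω →
      ((d : ℂ) + (b : ℂ) + Complex.I * (ω : ℂ))
          ∈ OrnsteinUhlenbeck.resolventSet (OrnsteinUhlenbeck.op d V) ∧
        ∀ (ℓ : ℕ) (Y : OrnsteinUhlenbeck.SphericalHarmonic d ℓ),
          ‖OrnsteinUhlenbeck.reducedResolvent V Y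
            ((d : ℂ) + (b : ℂ) + Complex.I * (ω : ℂ))‖ ≤ C := by
  have hdec : OrnsteinUhlenbeck.IsDecaying V K := by
    refine ⟨hVdiff.continuousOn, fun r hr => ?_⟩
    have := hV r hr
    rwa [Real.sq_sqrt (by positivity)] at this
  -- The maximum with `1` keeps `Im z` positive also when `K = 0`.
  refine ⟨2 / b, max 1 (4 * (K ^ 2 * (1 / 2 + 3 / (2 * b ^ 2) + 1 / (2 * b)))), fun ω hω => ?_⟩
  obtain ⟨R, hR, hRn⟩ := OrnsteinUhlenbeck.exists_isResolventAt_op (d := d) hdec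
    (z := (d : ℂ) + (b : ℂ) + Complex.I * (ω : ℂ)) hb (by simp)
    (by simpa using one_pos.trans_le ((le_max_left _ _).trans hω))
    (by simpa using (le_max_right _ _).trans hω)
  refine ⟨⟨R, hR⟩, fun ℓ Y => ?_⟩
  refine (OrnsteinUhlenbeck.norm_reducedResolvent_le V Y _).trans ?_
  rwa [hR.resolvent_eq]
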